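/- There is a constant $C>0$ such that the following holds for all $\mu>0$ and all $k\in\mathbb Z\setminus\{0\}$. Let $\hat\theta_0\in L^2(-1,1)$ and $g_1,g_2,g_3\in L^2L^2:=L^2((0,\infty);L^2(-1,1))$ (all functions complex valued), and let $\hat\theta=\hat\theta(t,y)$ be the solution on $(0,\infty)\times(-1,1)$ of \[ \bigl(\partial_t+\mu(k^2-\partial_y^2)+ik(1-y^2)\bigr)\hat\theta=-ikg_1-\partial_yg_2-g_3,\qquad \hat\theta(t,\pm1)=0,\qquad \hat\theta|_{t=0}=\hat\theta_0 , \] that is, the weak solution $\hat\theta\in C([0,\infty);L^2(-1,1))\cap L^2_{\rm loc}([0,\infty);H^1_0(-1,1))$. Then, with $L^\infty L^2:=L^\infty((0,\infty);L^2(-1,1))$, \[ \|\hat\theta\|_{L^\infty L^2}^2+(\mu|k|)^{1/2}\|\hat\theta\|_{L^2L^2}^2+\mu\bigl(\|\partial_y\hat\theta\|_{L^2L^2}^2+k^2\|\hat\theta\|_{L^2L^2}^2\bigr) \le C\Bigl(\|\hat\theta_0\|_{L^2}^2+\mu^{-1}\bigl(\|g_1\|_{L^2L^2}^2+\|g_2\|_{L^2L^2}^2\bigr)+\min\bigl\{(\mu|k|)^{-1/2},(\mu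 k^2)^{-1}\bigr\}\|g_3\|_{L^2L^2}^2\Bigr). \] -/

import Mathlib

open MeasureTheory Set
open scoped ENNReal ComplexConjugate

/-- Lebesgue measure on the interval `(-1, 1)`. -/
noncomputable abbrev volI : Measure ℝ := volume.restrict (Ioo (-1 : ℝ) 1)

/-- The complex Hilbert space `L²(-1, 1)`. -/
abbrev L2I : Type := Lp ℂ 2 volI

/-- Lebesgue measure on the half-line of times `(0, ∞)`. -/
noncomputable abbrev volT : Measure ℝ := volume.restrict (Ioi (0 : ℝ))

/-- `f` belongs to the Sobolev space `H¹₀(-1, 1)` and `d ∈ L²(-1, 1)` is its (weak) derivative: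
`f` has the absolutely continuous representative `y ↦ ∫_{-1}^y d`, which vanishes at `y = -1`,
and this representative also vanishes at `y = 1`. -/
def IsH10Deriv (f d : L2I) : Prop :=
  (∀ᵐ y ∂volI, f y = ∫ z in (-1 : ℝ)..y, d z) ∧ ∫ z in (-1 : ℝ)..1, d z = 0

/-- The pairing `⟨φ, (1 - y²) f⟩` in `L²(-1, 1)` (conjugate-linear in `φ`). -/
noncomputable def flowPairing (φ f : L2I) : ℂ :=
  ∫ y, conj (φ y) * (((1 - y ^ 2 : ℝ) : ℂ) * f y) ∂volI

/-- `θ` is a (finite energy) weak solution on `[0, ∞) × (-1, 1)` of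
`(∂_t + μ (k² - ∂_y²) + i k (1 - y²)) θ = - i k g₁ - ∂_y g₂ - g₃`, `θ(t, ±1) = 0`, `θ(0) = θ₀`,
with spatial derivative `Dθ = ∂_y θ`:
`θ ∈ C([0, ∞); L²) ∩ L²_loc([0, ∞); H¹₀)`, and the equation, integrated in time, holds when tested
against every `φ ∈ H¹₀(-1, 1)` (here `φ'` is the derivative of `φ`). -/
structure IsTempSolution (μ : ℝ) (k : ℤ) (θ₀ : L2I) (g₁ g₂ g₃ θ Dθ : ℝ → L2I) : Prop where
  continuousOn : ContinuousOn θ (Ici 0)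
  initial : θ 0 = θ₀
  memLp_deriv : ∀ T : ℝ, 0 < T → MemLp Dθ 2 (volume.restrict (Ioo 0 T))
  dirichlet : ∀ᵐ t ∂volT, IsH10Deriv (θ t) (Dθ t)
  weak : ∀ φ φ' : L2I, IsH10Deriv φ φ' → ∀ t : ℝ, 0 ≤ t →
    inner ℂ φ (θ t) - inner ℂ φ θ₀
      + ∫ s in (0 : ℝ)..t,
          ((μ : ℂ) * ((k : ℂ) ^ 2 * inner ℂ φ (θ s) + inner ℂ φ' (Dθ s))
            + Complex.I * (k : ℂ) * flowPairing φ (θ s))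
    = ∫ s in (0 : ℝ)..t,
          (-(Complex.I * (k : ℂ) * inner ℂ φ (g₁ s)) + inner ℂ φ' (g₂ s) - inner ℂ φ (g₃ s))

/-! The plain energy estimate gives everything except the enhanced dissipation term with rate `Λ =
(μ|k|)^(1/2)`, because the transport term `ik(1 - y²)` is skew-adjoint. That term is recovered by
hypocoercivity: the functional `40000 ‖θ‖² + σ Re⟨iAθ, θ⟩` is used, with `σ = sign k` and a
skew-adjoint operator `A` that is bounded on `L²`, so `L²` data suffice, and that maps into `H¹₀`,
so no boundary terms arise.

Put `δ = (μ/|k|)^(1/4)`, `ε = κδ`, `R = (1 - ε²∂_y²)⁻¹` with Dirichlet conditions, and `A = [R, W] =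
κε R(w∂_y + ∂_y w)R`, where `W' = w/δ = y/(δ² + y²)`. Up to errors, the commutator of `A` with `y²`
is `-4ε² R q R`, where `q = y²/(δ² + y²)` degenerates only near the critical point `y = 0`. An
uncertainty principle (`IsH10Deriv.norm_sq_le_weighted`) bounds the mass near `0` by `⟨f, q f⟩` and
`δ‖f‖‖f'‖`. Hence the transport term yields `-c|k|δ²‖θ‖² + C|k|δ⁴‖∂_yθ‖²`
(`IsMollifiedCommutator.transport_le`). Since `|k|δ² = Λ` and `|k|δ⁴ = μ`, the gain is the required
one and the loss is absorbed by the large multiple of the energy (`absorb_errors`).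

`R` is built without elliptic theory: it is the first component of the orthogonal projection of `(θ,
0)` onto the closed subspace of pairs `(f, εf')` in `L² × L²`. Differentiating `⟨Bθ, θ⟩` for a
merely weak solution is justified by `energy_identity`, whose proof uses only the strong continuity
of translations in `L²`. -/

/-! ### Absolutely continuous primitives and the product rule. -/

theorem absolutelyContinuousOnInterval_of_dist_le {X Y : Type*} [PseudoMetricSpace X]
    [PseudoMetricSpace Y] {f : ℝ → X} {g : ℝ → Y} {a b : ℝ}
    (hg : AbsolutelyContinuousOnInterval g a b)
    (h : ∀ x ∈ uIcc a b, ∀ y ∈ uIcc a b, dist (f x) (f y) ≤ dist (g x) (g y)) :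
    AbsolutelyContinuousOnInterval f a b := by
  rw [absolutelyContinuousOnInterval_iff] at hg ⊢
  intro ε hε
  obtain ⟨δ, hδ, H⟩ := hg ε hε
  refine ⟨δ, hδ, fun E hE hs => lt_of_le_of_lt (Finset.sum_le_sum fun i hi => ?_) (H E hE hs)⟩
  exact h _ (hE.1 i (by simpa using hi)).1 _ (hE.1 i (by simpa using hi)).2

theorem absolutelyContinuousOnInterval_primitive {f : ℝ → ℂ} {a b : ℝ}
    (hf : IntervalIntegrable f volume a b) (c : ℂ) :
    AbsolutelyContinuousOnInterval (fun x => c + ∫ z in a..x, f z) a b := by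
  have hn := hf.norm.absolutelyContinuousOnInterval_intervalIntegral (c := a) left_mem_uIcc
  refine absolutelyContinuousOnInterval_of_dist_le hn fun x hx y hy => ?_
  have hsub : ∀ z ∈ uIcc a b, IntervalIntegrable f volume a z := fun z hz =>
    hf.mono_set (uIcc_subset_uIcc_left hz)
  rw [dist_add_left, dist_eq_norm, Real.dist_eq,
    intervalIntegral.integral_interval_sub_left (hsub x hx) (hsub y hy),
    intervalIntegral.integral_interval_sub_left (hsub x hx).norm (hsub y hy).norm]
  exact intervalIntegral.norm_integral_le_abs_integral_norm

/-- Product rule for primitives of integrable functions. -/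
theorem integral_primitive_mul_primitive {f g : ℝ → ℂ} {a b : ℝ}
    (hf : IntervalIntegrable f volume a b) (hg : IntervalIntegrable g volume a b)
    (F G : ℝ → ℂ) (hF : ∀ x, F x = F a + ∫ z in a..x, f z)
    (hG : ∀ x, G x = G a + ∫ z in a..x, g z) {x : ℝ} (hx : x ∈ uIcc a b) :
    ∫ z in a..x, (f z * G z + F z * g z) = F x * G x - F a * G a := by
  have aF : AbsolutelyContinuousOnInterval F a b := by
    rw [show F = fun x => F a + ∫ z in a..x, f z from funext hF]
    exact absolutelyContinuousOnInterval_primitive hf _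
  have aG : AbsolutelyContinuousOnInterval G a b := by
    rw [show G = fun x => G a + ∫ z in a..x, g z from funext hG]
    exact absolutelyContinuousOnInterval_primitive hg _
  have hi : IntervalIntegrable (fun z => f z * G z + F z * g z) volume a b :=
    (hf.mul_continuousOn aG.continuousOn).add (hg.continuousOn_mul aF.continuousOn)
  have aP := absolutelyContinuousOnInterval_primitive hi 0
  have aQ := (aF.smul aG).sub aP
  -- `FG` minus the primitive of `fG + Fg` is absolutely continuous with zero derivative almost
  -- everywhere, hence constant.
  obtain ⟨C, hC⟩ := aQ.const_of_ae_hasDerivAt_zero (by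
    filter_upwards [hf.ae_hasDerivAt_integral, hg.ae_hasDerivAt_integral,
      hi.ae_hasDerivAt_integral] with y h1 h2 h3 hy
    have d1 : HasDerivAt F (f y) y := by
      rw [show F = fun x => F a + ∫ z in a..x, f z from funext hF]
      exact (h1 hy a left_mem_uIcc).const_add _
    have d2 : HasDerivAt G (g y) y := by
      rw [show G = fun x => G a + ∫ z in a..x, g z from funext hG]
      exact (h2 hy a left_mem_uIcc).const_add _
    have d3 := (d1.mul d2).sub ((h3 hy a left_mem_uIcc).const_add 0)
    rwa [sub_self] at d3)
  have e1 := hC x hx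
  have e2 := hC a left_mem_uIcc
  simp only [Pi.sub_apply, smul_eq_mul, Pi.mul_apply, zero_add,
    intervalIntegral.integral_same, sub_zero] at e1 e2
  rw [← e2] at e1
  linear_combination -e1

/-! ### Multiplication operators on `L²(-1, 1)`. -/

theorem exists_bound_on_Ioo (a : C(ℝ, ℝ)) : ∃ c : ℝ, 0 ≤ c ∧ ∀ y ∈ Ioo (-1 : ℝ) 1, |a y| ≤ c := by
  obtain ⟨c, hc⟩ := (isCompact_Icc (a := (-1 : ℝ)) (b := 1)).exists_bound_of_continuousOn
    a.continuous.continuousOn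
  exact ⟨c, (norm_nonneg _).trans (hc 0 (by norm_num)), fun y hy => hc y (Ioo_subset_Icc_self hy)⟩

theorem memLp_mul_of_bound (a : C(ℝ, ℝ)) (f : L2I) :
    MemLp (fun y => ((a y : ℝ) : ℂ) * f y) 2 volI := by
  obtain ⟨c, hc, h⟩ := exists_bound_on_Ioo a
  refine (Lp.memLp f).of_le_mul (c := c) ?_ ?_
  · exact ((Complex.continuous_ofReal.comp a.continuous).aestronglyMeasurable).mul
      (Lp.aestronglyMeasurable f)
  · filter_upwards [ae_restrict_mem measurableSet_Ioo] with y hy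
    rw [norm_mul, Complex.norm_real]
    gcongr
    exact h y hy

/-- Multiplication by a continuous real function, as a linear map on `L²(-1, 1)`. -/
noncomputable def mulLin (a : C(ℝ, ℝ)) : L2I →ₗ[ℂ] L2I where
  toFun f := (memLp_mul_of_bound a f).toLp
  map_add' f g := by
    ext1
    filter_upwards [(memLp_mul_of_bound a (f + g)).coeFn_toLp, (memLp_mul_of_bound a f).coeFn_toLp,
      (memLp_mul_of_bound a g).coeFn_toLp, Lp.coeFn_add f g,
      Lp.coeFn_add (memLp_mul_of_bound a f).toLp (memLp_mul_of_bound a g).toLp]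
      with y h1 h2 h3 h4 h5
    rw [h1, h5, Pi.add_apply, h2, h3, h4, Pi.add_apply, mul_add]
  map_smul' c f := by
    ext1
    filter_upwards [(memLp_mul_of_bound a (c • f)).coeFn_toLp, (memLp_mul_of_bound a f).coeFn_toLp,
      Lp.coeFn_smul c f, Lp.coeFn_smul c (memLp_mul_of_bound a f).toLp] with y h1 h2 h3 h4
    rw [h1, RingHom.id_apply, h4, Pi.smul_apply, h2, h3, Pi.smul_apply, smul_eq_mul, smul_eq_mul]
    ring

theorem coeFn_mulLin (a : C(ℝ, ℝ)) (f : L2I) :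
    mulLin a f =ᵐ[volI] fun y => ((a y : ℝ) : ℂ) * f y :=
  (memLp_mul_of_bound a f).coeFn_toLp

theorem norm_mulLin_le (a : C(ℝ, ℝ)) {c : ℝ} (h : ∀ y ∈ Ioo (-1 : ℝ) 1, |a y| ≤ c)
    (f : L2I) : ‖mulLin a f‖ ≤ c * ‖f‖ := by
  refine Lp.norm_le_mul_norm_of_ae_le_mul ?_
  filter_upwards [coeFn_mulLin a f, ae_restrict_mem measurableSet_Ioo] with y hy hy'
  rw [hy, norm_mul, Complex.norm_real]
  gcongr
  exact h y hy'

/-- Multiplication by a continuous real function, as a bounded operator on `L²(-1, 1)`. -/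
noncomputable def mulOp (a : C(ℝ, ℝ)) : L2I →L[ℂ] L2I :=
  (mulLin a).mkContinuous (exists_bound_on_Ioo a).choose
    (norm_mulLin_le a (exists_bound_on_Ioo a).choose_spec.2)

theorem coeFn_mulOp (a : C(ℝ, ℝ)) (f : L2I) :
    mulOp a f =ᵐ[volI] fun y => ((a y : ℝ) : ℂ) * f y :=
  coeFn_mulLin a f

theorem norm_mulOp_le (a : C(ℝ, ℝ)) {c : ℝ} (h : ∀ y ∈ Ioo (-1 : ℝ) 1, |a y| ≤ c)
    (f : L2I) : ‖mulOp a f‖ ≤ c * ‖f‖ :=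
  norm_mulLin_le a h f

theorem inner_mulOp_left (a : C(ℝ, ℝ)) (f g : L2I) :
    inner ℂ (mulOp a f) g = inner ℂ f (mulOp a g) := by
  rw [L2.inner_def, L2.inner_def]
  refine integral_congr_ae ?_
  filter_upwards [coeFn_mulOp a f, coeFn_mulOp a g] with y h1 h2
  rw [h1, h2, RCLike.inner_apply, RCLike.inner_apply, map_mul, Complex.conj_ofReal]
  ring

theorem mulOp_mulOp (a b : C(ℝ, ℝ)) (f : L2I) : mulOp a (mulOp b f) = mulOp (a * b) f := by
  ext1
  filter_upwards [coeFn_mulOp a (mulOp b f), coeFn_mulOp b f, coeFn_mulOp (a * b) f] with y h1 h2 h3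
  rw [h1, h2, h3, ContinuousMap.mul_apply, Complex.ofReal_mul, mul_assoc]

theorem mulOp_add (a b : C(ℝ, ℝ)) (f : L2I) : mulOp (a + b) f = mulOp a f + mulOp b f := by
  ext1
  filter_upwards [coeFn_mulOp a f, coeFn_mulOp b f, coeFn_mulOp (a + b) f,
    Lp.coeFn_add (mulOp a f) (mulOp b f)] with y h1 h2 h3 h4
  rw [h3, h4, Pi.add_apply, h1, h2, ContinuousMap.add_apply, Complex.ofReal_add, add_mul]

theorem mulOp_smul (r : ℝ) (a : C(ℝ, ℝ)) (f : L2I) :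
    mulOp (r • a) f = (r : ℂ) • mulOp a f := by
  ext1
  filter_upwards [coeFn_mulOp a f, coeFn_mulOp (r • a) f,
    Lp.coeFn_smul (r : ℂ) (mulOp a f)] with y h1 h2 h3
  rw [h3, Pi.smul_apply, h1, h2, ContinuousMap.smul_apply, smul_eq_mul, smul_eq_mul,
    Complex.ofReal_mul, mul_assoc]

theorem mulOp_one (f : L2I) : mulOp 1 f = f := by
  ext1
  filter_upwards [coeFn_mulOp 1 f] with y h1
  rw [h1, ContinuousMap.one_apply, Complex.ofReal_one, one_mul]

theorem re_inner_mulOp_mono {a b : C(ℝ, ℝ)} (h : ∀ y ∈ Ioo (-1 : ℝ) 1, a y ≤ b y) (f : L2I) :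
    (inner ℂ f (mulOp a f)).re ≤ (inner ℂ f (mulOp b f)).re := by
  have key : ∀ a : C(ℝ, ℝ), (inner ℂ f (mulOp a f)).re = ∫ y, a y * ‖f y‖ ^ 2 ∂volI ∧
      Integrable (fun y => a y * ‖f y‖ ^ 2) volI := by
    intro a
    have e : (fun y => inner ℂ (f y) (mulOp a f y)) =ᵐ[volI]
        fun y => ((a y * ‖f y‖ ^ 2 : ℝ) : ℂ) := by
      filter_upwards [coeFn_mulOp a f] with y h1
      rw [h1, RCLike.inner_apply, mul_assoc, Complex.mul_conj']
      push_cast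
      ring
    constructor
    · rw [L2.inner_def, integral_congr_ae e, integral_complex_ofReal, Complex.ofReal_re]
    · have := ((L2.integrable_inner f (mulOp a f)).congr e).re
      exact this.congr (ae_of_all _ fun y => Complex.ofReal_re _)
  rw [(key a).1, (key b).1]
  refine integral_mono_ae (key a).2 (key b).2 ?_
  filter_upwards [ae_restrict_mem measurableSet_Ioo] with y hy
  exact mul_le_mul_of_nonneg_right (h y hy) (by positivity)

theorem flowPairing_eq (φ f : L2I) (u : C(ℝ, ℝ)) (hu : ∀ y, u y = 1 - y ^ 2) :
    flowPairing φ f = inner ℂ φ (mulOp u f) := by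
  rw [L2.inner_def, flowPairing]
  refine integral_congr_ae ?_
  filter_upwards [coeFn_mulOp u f] with y h1
  rw [h1, RCLike.inner_apply, hu]
  ring

/-! ### Primitives of `L²` functions and calculus in `H¹₀(-1, 1)`. -/

theorem integrable_L2I (d : L2I) : Integrable d volI := (Lp.memLp d).integrable (by norm_num)

theorem intervalIntegrable_L2I (d : L2I) : IntervalIntegrable d volume (-1) 1 :=
  (intervalIntegrable_iff_integrableOn_Ioo_of_le (by norm_num)).2 (integrable_L2I d)

theorem intervalIntegrable_L2I_left (d : L2I) {y : ℝ} (hy : y ∈ Icc (-1 : ℝ) 1) :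
    IntervalIntegrable d volume (-1) y :=
  (intervalIntegrable_L2I d).mono_set (by
    rw [uIcc_of_le hy.1, uIcc_of_le (hy.1.trans hy.2)]; exact Icc_subset_Icc_right hy.2)

theorem integral_primitive_eq_setIntegral (d : ℝ → ℂ) {y : ℝ} (hy : y ∈ Icc (-1 : ℝ) 1) :
    ∫ z in (-1 : ℝ)..y, d z = ∫ z in Iio y, d z ∂volI := by
  rw [intervalIntegral.integral_of_le hy.1, integral_Ioc_eq_integral_Ioo,
    Measure.restrict_restrict measurableSet_Iio]
  congr 2
  ext z
  simp only [mem_Ioo, mem_inter_iff, mem_Iio]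
  constructor
  · rintro ⟨h1, h2⟩; exact ⟨h2, h1, h2.trans_le hy.2⟩
  · rintro ⟨h1, h2, h3⟩; exact ⟨h2, h1⟩

/-- Cauchy–Schwarz against the indicator of `Iio y`; the constant 2 is a crude bound for `√2`. -/
theorem norm_integral_primitive_le (d : L2I) {y : ℝ} (hy : y ∈ Icc (-1 : ℝ) 1) :
    ‖∫ z in (-1 : ℝ)..y, d z‖ ≤ 2 * ‖d‖ := by
  rw [integral_primitive_eq_setIntegral _ hy]
  have h := L2.inner_indicatorConstLp_one (𝕜 := ℂ) (measurableSet_Iio (a := y))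
    (measure_ne_top volI _) d
  rw [← h]
  refine (norm_inner_le_norm _ _).trans ?_
  gcongr
  refine (norm_indicatorConstLp_le).trans ?_
  have : volI.real (Iio y) ≤ 2 := by
    refine (measureReal_mono (subset_univ _)).trans ?_
    simp [Measure.real]; norm_num
  rw [norm_one, one_mul]
  calc volI.real (Iio y) ^ (1 / (2 : ℝ≥0∞).toReal) ≤ 2 ^ (1 / (2 : ℝ≥0∞).toReal) := by
        gcongr
    _ ≤ 2 ^ (1 : ℝ) := Real.rpow_le_rpow_of_exponent_le (by norm_num) (by norm_num)
    _ = 2 := by norm_num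

theorem continuousOn_primitive_L2I (d : L2I) :
    ContinuousOn (fun y => ∫ z in (-1 : ℝ)..y, d z) (Icc (-1) 1) := by
  have := intervalIntegral.continuousOn_primitive_interval' (intervalIntegrable_L2I d)
    (left_mem_uIcc)
  rwa [uIcc_of_le (by norm_num)] at this

theorem memLp_primitive (d : L2I) : MemLp (fun y => ∫ z in (-1 : ℝ)..y, d z) 2 volI := by
  refine MemLp.of_bound (((continuousOn_primitive_L2I d).mono
    Ioo_subset_Icc_self).aestronglyMeasurable measurableSet_Ioo) (2 * ‖d‖) ?_
  filter_upwards [ae_restrict_mem measurableSet_Ioo] with y hy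
  exact norm_integral_primitive_le d (Ioo_subset_Icc_self hy)

theorem primitive_congr {d e : ℝ → ℂ} (h : d =ᵐ[volI] e) {y : ℝ} (hy : y ∈ Icc (-1 : ℝ) 1) :
    ∫ z in (-1 : ℝ)..y, d z = ∫ z in (-1 : ℝ)..y, e z := by
  rw [integral_primitive_eq_setIntegral _ hy, integral_primitive_eq_setIntegral _ hy]
  exact integral_congr_ae (ae_restrict_of_ae h)

theorem primitive_add (d e : L2I) {y : ℝ} (hy : y ∈ Icc (-1 : ℝ) 1) :
    ∫ z in (-1 : ℝ)..y, (d + e : L2I) z = (∫ z in (-1 : ℝ)..y, d z) + ∫ z in (-1 : ℝ)..y, e z := by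
  rw [primitive_congr (Lp.coeFn_add d e) hy]
  exact intervalIntegral.integral_add (intervalIntegrable_L2I_left d hy)
    (intervalIntegrable_L2I_left e hy)

theorem primitive_smul (c : ℂ) (d : L2I) {y : ℝ} (hy : y ∈ Icc (-1 : ℝ) 1) :
    ∫ z in (-1 : ℝ)..y, (c • d : L2I) z = c * ∫ z in (-1 : ℝ)..y, d z := by
  rw [primitive_congr (Lp.coeFn_smul c d) hy]
  exact intervalIntegral.integral_smul c _

theorem one_mem_Icc : (1 : ℝ) ∈ Icc (-1 : ℝ) 1 := by norm_num

theorem IsH10Deriv.add {f d g e : L2I} (h : IsH10Deriv f d) (h' : IsH10Deriv g e) :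
    IsH10Deriv (f + g) (d + e) := by
  refine ⟨?_, ?_⟩
  · filter_upwards [h.1, h'.1, Lp.coeFn_add f g, ae_restrict_mem measurableSet_Ioo]
      with y h1 h2 h3 hy
    rw [h3, Pi.add_apply, h1, h2, primitive_add d e (Ioo_subset_Icc_self hy)]
  · rw [primitive_add d e one_mem_Icc, h.2, h'.2, add_zero]

theorem IsH10Deriv.smul {f d : L2I} (h : IsH10Deriv f d) (c : ℂ) :
    IsH10Deriv (c • f) (c • d) := by
  refine ⟨?_, ?_⟩
  · filter_upwards [h.1, Lp.coeFn_smul c f, ae_restrict_mem measurableSet_Ioo]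
      with y h1 h3 hy
    rw [h3, Pi.smul_apply, h1, primitive_smul c d (Ioo_subset_Icc_self hy), smul_eq_mul]
  · rw [primitive_smul c d one_mem_Icc, h.2, mul_zero]

theorem IsH10Deriv.zero : IsH10Deriv 0 0 := by
  have h : ∀ y ∈ Icc (-1 : ℝ) 1, ∫ z in (-1 : ℝ)..y, (0 : L2I) z = 0 := fun y hy => by
    rw [primitive_congr (Lp.coeFn_zero ℂ 2 volI) hy]; simp
  refine ⟨?_, h 1 one_mem_Icc⟩
  filter_upwards [Lp.coeFn_zero ℂ 2 volI, ae_restrict_mem measurableSet_Ioo] with y h1 hy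
  rw [h1, h y (Ioo_subset_Icc_self hy), Pi.zero_apply]

theorem IsH10Deriv.sub {f d g e : L2I} (h : IsH10Deriv f d) (h' : IsH10Deriv g e) :
    IsH10Deriv (f - g) (d - e) := by
  simpa [sub_eq_add_neg] using h.add (h'.smul (-1))

/-- The Volterra operator `d ↦ ∫_{-1}^y d` on `L²(-1, 1)`. -/
noncomputable def volterraLin : L2I →ₗ[ℂ] L2I where
  toFun d := (memLp_primitive d).toLp
  map_add' d e := by
    ext1
    filter_upwards [(memLp_primitive (d + e)).coeFn_toLp, (memLp_primitive d).coeFn_toLp,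
      (memLp_primitive e).coeFn_toLp, ae_restrict_mem measurableSet_Ioo,
      Lp.coeFn_add (memLp_primitive d).toLp (memLp_primitive e).toLp] with y h1 h2 h3 hy h5
    rw [h1, h5, Pi.add_apply, h2, h3, primitive_add d e (Ioo_subset_Icc_self hy)]
  map_smul' c d := by
    ext1
    filter_upwards [(memLp_primitive (c • d)).coeFn_toLp, (memLp_primitive d).coeFn_toLp,
      ae_restrict_mem measurableSet_Ioo,
      Lp.coeFn_smul c (memLp_primitive d).toLp] with y h1 h2 hy h5
    rw [h1, RingHom.id_apply, h5, Pi.smul_apply, h2, primitive_smul c d (Ioo_subset_Icc_self hy),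
      smul_eq_mul]

theorem exists_norm_volterraLin_le : ∃ C : ℝ, ∀ d, ‖volterraLin d‖ ≤ C * ‖d‖ := by
  refine ⟨(volI.real univ) ^ ((2 : ℝ≥0∞).toReal)⁻¹ * 2, fun d => ?_⟩
  rw [mul_assoc]
  refine Lp.norm_le_of_ae_bound (by positivity) ?_
  filter_upwards [(memLp_primitive d).coeFn_toLp, ae_restrict_mem measurableSet_Ioo] with y h1 hy
  exact h1.symm ▸ norm_integral_primitive_le d (Ioo_subset_Icc_self hy)

/-- The set is the graph of the bounded Volterra operator, cut by the kernel of the bounded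
functional `d ↦ ∫ d`. Closedness is what makes the orthogonal projection onto `scaledH10` available.
-/
theorem isClosed_setOf_isH10Deriv : IsClosed {x : L2I × L2I | IsH10Deriv x.1 x.2} := by
  obtain ⟨C, hC⟩ := exists_norm_volterraLin_le
  let J : L2I →L[ℂ] L2I := volterraLin.mkContinuous C hC
  let l : L2I →L[ℂ] ℂ := LinearMap.mkContinuous
    { toFun := fun d => ∫ z in (-1 : ℝ)..1, d z
      map_add' := fun d e => primitive_add d e one_mem_Icc
      map_smul' := fun c d => primitive_smul c d one_mem_Icc } 2
    (fun d => norm_integral_primitive_le d one_mem_Icc)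
  have e : {x : L2I × L2I | IsH10Deriv x.1 x.2} = {x | x.1 = J x.2} ∩ {x | l x.2 = 0} := by
    ext x
    refine and_congr ⟨fun h => ?_, fun h => ?_⟩ Iff.rfl
    · exact Lp.ext (Filter.EventuallyEq.trans h (memLp_primitive x.2).coeFn_toLp.symm)
    · change x.1 = J x.2 at h
      rw [h]
      exact (memLp_primitive x.2).coeFn_toLp
  rw [e]
  exact (isClosed_eq continuous_fst (J.continuous.comp continuous_snd)).inter
    (isClosed_eq (l.continuous.comp continuous_snd) continuous_const)

/-- Product rule in `H¹₀(-1, 1)`. -/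
theorem IsH10Deriv.mulOp {f d : L2I} (h : IsH10Deriv f d) (a a' : C(ℝ, ℝ))
    (ha : ∀ y, HasDerivAt a (a' y) y) :
    IsH10Deriv (mulOp a f) (mulOp a' f + mulOp a d) := by
  have hA : ∀ x, ((a x : ℝ) : ℂ) = (a (-1) : ℂ) + ∫ z in (-1 : ℝ)..x, ((a' z : ℝ) : ℂ) := by
    intro x
    rw [intervalIntegral.integral_ofReal, intervalIntegral.integral_eq_sub_of_hasDerivAt
      (fun y _ => ha y) (a'.continuous.intervalIntegrable _ _)]
    push_cast
    ring
  have key : ∀ y ∈ Icc (-1 : ℝ) 1, ∫ z in (-1 : ℝ)..y, (_root_.mulOp a' f + _root_.mulOp a d : L2I) z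
      = a y * ∫ z in (-1 : ℝ)..y, d z := by
    intro y hy
    have hc : ((_root_.mulOp a' f + _root_.mulOp a d : L2I) : ℝ → ℂ) =ᵐ[volI]
        fun z => (a' z : ℂ) * (∫ x in (-1 : ℝ)..z, d x) + (a z : ℂ) * d z := by
      filter_upwards [Lp.coeFn_add (_root_.mulOp a' f) (_root_.mulOp a d), coeFn_mulOp a' f,
        coeFn_mulOp a d, h.1] with z h1 h2 h3 h4
      rw [h1, Pi.add_apply, h2, h3, h4]
    rw [primitive_congr hc hy]
    have := integral_primitive_mul_primitive (a := -1) (b := 1) (f := fun z => (a' z : ℂ)) (g := d)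
      ((Complex.continuous_ofReal.comp a'.continuous).intervalIntegrable _ _)
      (intervalIntegrable_L2I d) (fun y => (a y : ℂ)) (fun y => ∫ z in (-1 : ℝ)..y, d z) hA
      (by simp) (x := y) (by rwa [uIcc_of_le (by norm_num)])
    rw [this]
    simp
  refine ⟨?_, ?_⟩
  · filter_upwards [coeFn_mulOp a f, h.1, ae_restrict_mem measurableSet_Ioo] with y h1 h2 hy
    rw [h1, h2, key y (Ioo_subset_Icc_self hy)]
  · rw [key 1 one_mem_Icc, h.2, mul_zero]

/-- Integration by parts in `H¹₀(-1, 1)`. -/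
theorem IsH10Deriv.inner_add_inner {f d g e : L2I} (h : IsH10Deriv f d) (h' : IsH10Deriv g e) :
    inner ℂ d g + inner ℂ f e = 0 := by
  have hcd : IntervalIntegrable (fun z => conj (d z)) volume (-1) 1 := by
    have := intervalIntegrable_L2I d
    rw [intervalIntegrable_iff_integrableOn_Ioo_of_le (by norm_num)] at this ⊢
    exact (Complex.conjLIE.toContinuousLinearEquiv : ℂ →L[ℝ] ℂ).integrable_comp this
  have := integral_primitive_mul_primitive (a := -1) (b := 1) hcd
      (intervalIntegrable_L2I e) (fun y => ∫ z in (-1 : ℝ)..y, conj (d z))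
      (fun y => ∫ z in (-1 : ℝ)..y, e z) (by simp) (by simp) (x := 1) right_mem_uIcc
  rw [h'.2, intervalIntegral.integral_same, intervalIntegral.integral_same, mul_zero, mul_zero,
    sub_zero, intervalIntegral.integral_of_le (by norm_num), integral_Ioc_eq_integral_Ioo] at this
  rw [L2.inner_def, L2.inner_def, ← integral_add (L2.integrable_inner d g) (L2.integrable_inner f e),
    ← this]
  refine integral_congr_ae ?_
  filter_upwards [h.1, h'.1, ae_restrict_mem measurableSet_Ioo] with y h1 h2 hy
  have hc : ∫ z in (-1 : ℝ)..y, conj (d z) = conj (∫ z in (-1 : ℝ)..y, d z) := by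
    rw [intervalIntegral.integral_of_le hy.1.le, intervalIntegral.integral_of_le hy.1.le]
    exact integral_conj
  rw [RCLike.inner_apply, RCLike.inner_apply, h1, h2, hc]
  ring

/-! ### The Hilbert space of pairs `(f, ε f')`. -/

/-- Pairs `(f, ε f')` with `f ∈ H¹₀(-1, 1)`, as a subspace of the Hilbert space `L² × L²`. -/
noncomputable def scaledH10 (ε : ℝ) : Submodule ℂ (WithLp 2 (L2I × L2I)) where
  carrier := {x | IsH10Deriv x.fst ((ε⁻¹ : ℂ) • x.snd)}
  add_mem' {x y} hx hy := by
    have := IsH10Deriv.add hx hy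
    rwa [← smul_add] at this
  zero_mem' := by
    change IsH10Deriv 0 ((ε⁻¹ : ℂ) • (0 : L2I))
    rw [smul_zero]; exact IsH10Deriv.zero
  smul_mem' c x hx := by
    have := IsH10Deriv.smul hx c
    rwa [smul_comm] at this

theorem isClosed_scaledH10 (ε : ℝ) :
    IsClosed (scaledH10 ε : Set (WithLp 2 (L2I × L2I))) := by
  have hc : Continuous fun x : WithLp 2 (L2I × L2I) => (x.fst, (ε⁻¹ : ℂ) • x.snd) :=
    ((WithLp.fstL 2 ℂ L2I L2I).continuous).prodMk
      ((continuous_const (y := (ε⁻¹ : ℂ))).smul (WithLp.sndL 2 ℂ L2I L2I).continuous)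
  exact isClosed_setOf_isH10Deriv.preimage hc

instance (ε : ℝ) : CompleteSpace (scaledH10 ε) := (isClosed_scaledH10 ε).completeSpace_coe

theorem mem_scaledH10 {ε : ℝ} (hε : ε ≠ 0) {f d : L2I} (h : IsH10Deriv f d) :
    WithLp.toLp 2 (f, (ε : ℂ) • d) ∈ scaledH10 ε := by
  change IsH10Deriv f ((ε⁻¹ : ℂ) • (ε : ℂ) • d)
  rwa [smul_smul, inv_mul_cancel₀ (by exact_mod_cast hε), one_smul]

/-! ### The uncertainty principle at the critical point. -/

theorem re_inner_symm (f g : L2I) : (inner ℂ f g).re = (inner ℂ g f).re :=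
  inner_re_symm (𝕜 := ℂ) f g

theorem abs_re_inner_le (f g : L2I) : |(inner ℂ f g).re| ≤ ‖f‖ * ‖g‖ :=
  (Complex.abs_re_le_norm _).trans (norm_inner_le_norm f g)

theorem re_inner_self (f : L2I) : (inner ℂ f f).re = ‖f‖ ^ 2 := by
  rw [inner_self_eq_norm_sq_to_K]
  norm_cast

theorem conj_two : (starRingEnd ℂ) (2 : ℂ) = ((2 : ℝ) : ℂ) := Complex.conj_ofReal 2

theorem IsH10Deriv.mulOp_id {f d : L2I} (h : IsH10Deriv f d) :
    IsH10Deriv (_root_.mulOp (.id ℝ) f) (f + _root_.mulOp (.id ℝ) d) := by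
  have := h.mulOp (.id ℝ) 1 (fun y => hasDerivAt_id y)
  rwa [mulOp_one] at this

theorem IsH10Deriv.mulOp_sq {f d : L2I} (h : IsH10Deriv f d) :
    IsH10Deriv (_root_.mulOp (.id ℝ) (_root_.mulOp (.id ℝ) f))
      ((2 : ℂ) • _root_.mulOp (.id ℝ) f + _root_.mulOp (.id ℝ) (_root_.mulOp (.id ℝ) d)) := by
  have := h.mulOp_id.mulOp_id
  rw [map_add] at this
  rwa [two_smul, add_assoc]

/-- An uncertainty principle: a function in `H¹₀` cannot concentrate at the critical point below
scale `δ`. -/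
theorem IsH10Deriv.norm_sq_le_weighted {δ : ℝ} (hδ : 0 < δ) {q : C(ℝ, ℝ)}
    (hq : ∀ y, q y = y ^ 2 / (δ ^ 2 + y ^ 2)) {w : C(ℝ, ℝ)}
    (hw : ∀ y, w y = δ * y / (δ ^ 2 + y ^ 2)) (hw2 : ∀ y, |w y| ≤ 1 / 2)
    {f d : L2I} (h : IsH10Deriv f d) :
    ‖f‖ ^ 2 ≤ 3 * (inner ℂ f (_root_.mulOp q f)).re + δ * (‖f‖ * ‖d‖) := by
  have hpos : ∀ y : ℝ, 0 < δ ^ 2 + y ^ 2 := fun y => by positivity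
  let w' : C(ℝ, ℝ) := ⟨fun y => δ * (δ ^ 2 - y ^ 2) / (δ ^ 2 + y ^ 2) ^ 2, by
    refine Continuous.div (by fun_prop) (by fun_prop) fun y => (pow_pos (hpos y) 2).ne'⟩
  have hd : ∀ y, HasDerivAt w (w' y) y := by
    intro y
    have e : (w : ℝ → ℝ) = fun y => δ * y / (δ ^ 2 + y ^ 2) := funext hw
    rw [e]
    have := ((hasDerivAt_id y).const_mul δ).div (((hasDerivAt_id y).pow 2).const_add (δ ^ 2))
      (hpos y).ne'
    refine this.congr_deriv ?_
    simp only [w', ContinuousMap.coe_mk, id, Pi.pow_apply]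
    congr 1
    push_cast
    ring
  -- Integration by parts gives `∫ w'|f|² = -2 Re ∫ w f̄ f'`, at most `‖f‖‖d‖` since `|w| ≤ 1/2`.
  -- The pointwise bound `1 - 3q ≤ δw'` then concludes.
  have ibp := h.inner_add_inner (h.mulOp w w' hd)
  have ibp' := congrArg Complex.re ibp
  rw [inner_add_right, Complex.add_re, Complex.add_re, Complex.zero_re] at ibp'
  have hwb : ∀ g : L2I, ‖_root_.mulOp w g‖ ≤ 1 / 2 * ‖g‖ :=
    norm_mulOp_le w (fun y _ => hw2 y)
  have b1 : -(inner ℂ d (_root_.mulOp w f)).re ≤ ‖d‖ * (1 / 2 * ‖f‖) :=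
    (neg_le_abs _).trans ((abs_re_inner_le _ _).trans (by gcongr; exact hwb f))
  have b2 : -(inner ℂ f (_root_.mulOp w d)).re ≤ ‖f‖ * (1 / 2 * ‖d‖) :=
    (neg_le_abs _).trans ((abs_re_inner_le _ _).trans (by gcongr; exact hwb d))
  have mono : (inner ℂ f (_root_.mulOp (1 + (-3 : ℝ) • q) f)).re ≤
      (inner ℂ f (_root_.mulOp (δ • w') f)).re := by
    refine re_inner_mulOp_mono (fun y _ => ?_) f
    simp only [ContinuousMap.add_apply, ContinuousMap.one_apply, ContinuousMap.smul_apply,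
      smul_eq_mul, w', ContinuousMap.coe_mk, hq]
    have e1 : 1 + -3 * (y ^ 2 / (δ ^ 2 + y ^ 2)) =
        (δ ^ 2 - 2 * y ^ 2) * (δ ^ 2 + y ^ 2) / (δ ^ 2 + y ^ 2) ^ 2 := by
      have := (hpos y).ne'
      field_simp
      ring
    rw [e1, ← mul_div_assoc]
    refine div_le_div_of_nonneg_right ?_ (by positivity)
    nlinarith [sq_nonneg (y ^ 2)]
  rw [mulOp_add, mulOp_smul, mulOp_smul, mulOp_one, inner_add_right, inner_smul_right,
    inner_smul_right, Complex.add_re, Complex.re_ofReal_mul, Complex.re_ofReal_mul,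
    re_inner_self] at mono
  have : δ * (inner ℂ f (_root_.mulOp w' f)).re ≤ δ * (‖f‖ * ‖d‖) := by
    gcongr
    linarith
  linarith

/-! ### Estimates for the mollified commutator. -/

/-- `ρ = (1 - ε² ∂_y²)⁻¹ θ` and `e = (1 - ε² ∂_y²)⁻¹ (κ ε (w ∂_y ρ + ∂_y (w ρ)))`, both with
Dirichlet conditions, where `ε = κ δ`, in weak form. -/
structure IsMollifiedCommutator (δ κ : ℝ) (w : C(ℝ, ℝ)) (θ ρ ρ' e e' : L2I) : Prop where
  h10_rho : IsH10Deriv ρ ρ'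
  h10_e : IsH10Deriv e e'
  eq_rho : ∀ φ φ' : L2I, IsH10Deriv φ φ' →
    inner ℂ φ ρ + ((κ * δ) ^ 2 : ℝ) * inner ℂ φ' ρ' = inner ℂ φ θ
  eq_e : ∀ φ φ' : L2I, IsH10Deriv φ φ' →
    inner ℂ φ e + ((κ * δ) ^ 2 : ℝ) * inner ℂ φ' e' =
      (κ * (κ * δ) : ℝ) * (inner ℂ φ (mulOp w ρ') - inner ℂ φ' (mulOp w ρ))

namespace IsMollifiedCommutator

variable {δ κ : ℝ} {w : C(ℝ, ℝ)} {θ ρ ρ' e e' : L2I}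

theorem re_eq_rho (h : IsMollifiedCommutator δ κ w θ ρ ρ' e e') {φ φ' : L2I}
    (hφ : IsH10Deriv φ φ') :
    (inner ℂ φ ρ).re + (κ * δ) ^ 2 * (inner ℂ φ' ρ').re = (inner ℂ φ θ).re := by
  rw [← h.eq_rho φ φ' hφ, Complex.add_re, Complex.re_ofReal_mul]

theorem re_eq_e (h : IsMollifiedCommutator δ κ w θ ρ ρ' e e') {φ φ' : L2I}
    (hφ : IsH10Deriv φ φ') :
    (inner ℂ φ e).re + (κ * δ) ^ 2 * (inner ℂ φ' e').re =
      κ * (κ * δ) * ((inner ℂ φ (mulOp w ρ')).re - (inner ℂ φ' (mulOp w ρ)).re) := by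
  have := congrArg Complex.re (h.eq_e φ φ' hφ)
  rwa [Complex.add_re, Complex.re_ofReal_mul, Complex.re_ofReal_mul, Complex.sub_re] at this

theorem norm_rho_le (h : IsMollifiedCommutator δ κ w θ ρ ρ' e e') : ‖ρ‖ ≤ ‖θ‖ := by
  have h1 := h.re_eq_rho h.h10_rho
  rw [re_inner_self, re_inner_self] at h1
  have h2 := (le_abs_self _).trans (abs_re_inner_le ρ θ)
  nlinarith [norm_nonneg ρ, norm_nonneg θ, sq_nonneg (κ * δ * ‖ρ'‖)]

theorem norm_rho_deriv_le (h : IsMollifiedCommutator δ κ w θ ρ ρ' e e') :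
    κ * δ * ‖ρ'‖ ≤ ‖θ‖ := by
  have h1 := h.re_eq_rho h.h10_rho
  rw [re_inner_self, re_inner_self] at h1
  have h2 := (le_abs_self _).trans (abs_re_inner_le ρ θ)
  refine abs_le_of_sq_le_sq' ?_ (norm_nonneg θ) |>.2
  nlinarith [sq_nonneg (‖ρ‖ - ‖θ‖), sq_nonneg (‖ρ‖), h.norm_rho_le, norm_nonneg ρ, norm_nonneg θ]

/-- The test function `ρ - θ` is admissible because `θ` itself lies in `H¹₀`; it gives `‖ρ - θ‖² +
ε²‖ρ'‖² ≤ ε²‖D‖‖ρ'‖`. -/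
theorem norm_rho_deriv_le_deriv (h : IsMollifiedCommutator δ κ w θ ρ ρ' e e') (hε : 0 < κ * δ)
    {D : L2I} (hθ : IsH10Deriv θ D) : ‖ρ'‖ ≤ ‖D‖ ∧ ‖ρ - θ‖ ≤ κ * δ * ‖D‖ := by
  have h1 := h.re_eq_rho (h.h10_rho.sub hθ)
  have e1 : (inner ℂ (ρ - θ) ρ).re - (inner ℂ (ρ - θ) θ).re = ‖ρ - θ‖ ^ 2 := by
    rw [← re_inner_self, inner_sub_right, Complex.sub_re]
  have e2 : (inner ℂ (ρ' - D) ρ').re = ‖ρ'‖ ^ 2 - (inner ℂ D ρ').re := by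
    rw [inner_sub_left, Complex.sub_re, re_inner_self]
  have h2 := (le_abs_self _).trans (abs_re_inner_le D ρ')
  rw [e2] at h1
  have h3 : ‖ρ - θ‖ ^ 2 + (κ * δ) ^ 2 * ‖ρ'‖ ^ 2 ≤ (κ * δ) ^ 2 * (‖D‖ * ‖ρ'‖) := by
    nlinarith [mul_le_mul_of_nonneg_left h2 (sq_nonneg (κ * δ))]
  have h4 : ‖ρ'‖ ≤ ‖D‖ := by
    by_contra! hlt
    have : (κ * δ) ^ 2 * (‖D‖ * ‖ρ'‖) < (κ * δ) ^ 2 * ‖ρ'‖ ^ 2 := by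
      have := norm_nonneg D
      have h0 : 0 < ‖ρ'‖ := by linarith
      rw [sq ‖ρ'‖]
      gcongr
    nlinarith [sq_nonneg (‖ρ - θ‖)]
  refine ⟨h4, abs_le_of_sq_le_sq' ?_ (by positivity) |>.2⟩
  have : (κ * δ) ^ 2 * (‖D‖ * ‖ρ'‖) ≤ (κ * δ) ^ 2 * (‖D‖ * ‖D‖) := by gcongr
  nlinarith [mul_nonneg (sq_nonneg (κ * δ)) (sq_nonneg ‖ρ'‖)]

/-- Testing with `e`: the factor `ε` in the source compensates the derivative on `ρ` or `e`, so only
the small factor `κ` remains. -/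
theorem norm_e_le (h : IsMollifiedCommutator δ κ w θ ρ ρ' e e') (hκ : 0 ≤ κ) (hδ : 0 ≤ δ)
    (hw2 : ∀ y, |w y| ≤ 1 / 2) : ‖e‖ ≤ κ * ‖θ‖ ∧ κ * δ * ‖e'‖ ≤ κ * ‖θ‖ := by
  have h1 := h.re_eq_e h.h10_e
  rw [re_inner_self, re_inner_self] at h1
  have hwb : ∀ g : L2I, ‖mulOp w g‖ ≤ 1 / 2 * ‖g‖ := norm_mulOp_le w (fun y _ => hw2 y)
  have hε : 0 ≤ κ * δ := by positivity
  have b1 : (inner ℂ e (mulOp w ρ')).re ≤ ‖e‖ * (1 / 2 * ‖ρ'‖) :=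
    (le_abs_self _).trans ((abs_re_inner_le _ _).trans (by gcongr; exact hwb _))
  have b2 : -(inner ℂ e' (mulOp w ρ)).re ≤ ‖e'‖ * (1 / 2 * ‖ρ‖) :=
    (neg_le_abs _).trans ((abs_re_inner_le _ _).trans (by gcongr; exact hwb _))
  have r1 := h.norm_rho_le
  have r2 := h.norm_rho_deriv_le
  set x := ‖e‖
  set z := κ * δ * ‖e'‖
  have hx : 0 ≤ x := norm_nonneg _
  have hz : 0 ≤ z := by positivity
  set c := κ * ‖θ‖ / 2
  have hc : 0 ≤ c := by positivity
  have key : x ^ 2 + z ^ 2 ≤ c * (x + z) := by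
    calc x ^ 2 + z ^ 2 = ‖e‖ ^ 2 + (κ * δ) ^ 2 * ‖e'‖ ^ 2 := by ring
      _ = κ * (κ * δ) * ((inner ℂ e (mulOp w ρ')).re - (inner ℂ e' (mulOp w ρ)).re) := h1
      _ ≤ κ * (κ * δ) * (‖e‖ * (1 / 2 * ‖ρ'‖) + ‖e'‖ * (1 / 2 * ‖ρ‖)) := by gcongr; linarith
      _ = κ / 2 * (x * (κ * δ * ‖ρ'‖) + z * ‖ρ‖) := by ring
      _ ≤ κ / 2 * (x * ‖θ‖ + z * ‖θ‖) := by gcongr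
      _ = c * (x + z) := by ring
  have e0 : κ * ‖θ‖ = 2 * c := by ring
  rw [e0]
  constructor
  · nlinarith [sq_nonneg (2 * z - c)]
  · nlinarith [sq_nonneg (2 * x - c)]

/-- The weight `y` gains a factor `δ` over `norm_e_le`, because `|y w| ≤ δ`. The equation for `e` is
tested with `y² e`, and the terms from differentiating `y²` are absorbed. -/
theorem norm_id_e_le (h : IsMollifiedCommutator δ κ w θ ρ ρ' e e') (hκ : 0 ≤ κ) (hδ : 0 ≤ δ)
    (hκ' : κ ≤ 1 / 36) (hw2 : ∀ y, |w y| ≤ 1 / 2) (hyw : ∀ y, |(ContinuousMap.id ℝ * w) y| ≤ δ) :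
    ‖mulOp (.id ℝ) e‖ ≤ 3 * (κ * δ * ‖θ‖) := by
  have h1 := h.re_eq_e h.h10_e.mulOp_sq
  simp only [inner_add_left, inner_smul_left, inner_mulOp_left, Complex.add_re] at h1
  simp only [← inner_mulOp_left (.id ℝ) e, ← inner_mulOp_left (.id ℝ) e', re_inner_self,
    mulOp_mulOp (.id ℝ) w] at h1
  have hwb : ∀ g : L2I, ‖mulOp w g‖ ≤ 1 / 2 * ‖g‖ := norm_mulOp_le w (fun y _ => hw2 y)
  have hywb : ∀ g : L2I, ‖mulOp (.id ℝ * w) g‖ ≤ δ * ‖g‖ := norm_mulOp_le _ (fun y _ => hyw y)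
  have hε : 0 ≤ κ * δ := by positivity
  have r1 := h.norm_rho_le
  have r2 := h.norm_rho_deriv_le
  have r3 := (h.norm_e_le hκ hδ hw2).2
  rw [conj_two, Complex.re_ofReal_mul,
    Complex.re_ofReal_mul] at h1
  set A := ‖mulOp (.id ℝ) e‖
  set B := ‖mulOp (.id ℝ) e'‖
  have hA : 0 ≤ A := norm_nonneg _
  have hB : 0 ≤ B := norm_nonneg _
  have b1 : -(inner ℂ (mulOp (.id ℝ) e) e').re ≤ A * ‖e'‖ :=
    (neg_le_abs _).trans (abs_re_inner_le _ _)
  have b2 : (inner ℂ (mulOp (.id ℝ) e) (mulOp (.id ℝ * w) ρ')).re ≤ A * (δ * ‖ρ'‖) :=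
    (le_abs_self _).trans ((abs_re_inner_le _ _).trans (by gcongr; exact hywb _))
  have b3 : -(inner ℂ e (mulOp (.id ℝ * w) ρ)).re ≤ ‖e‖ * (δ * ‖ρ‖) :=
    (neg_le_abs _).trans ((abs_re_inner_le _ _).trans (by gcongr; exact hywb _))
  have b4 : -(inner ℂ (mulOp (.id ℝ) e') (mulOp (.id ℝ * w) ρ)).re ≤ B * (δ * ‖ρ‖) :=
    (neg_le_abs _).trans ((abs_re_inner_le _ _).trans (by gcongr; exact hywb _))
  set x := κ * δ * ‖θ‖ with hx
  have hx0 : 0 ≤ x := by positivity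
  have key : A ^ 2 + (κ * δ * B) ^ 2 ≤
      2 * A * (κ * x) + A * x + 2 * κ * x ^ 2 + (κ * δ * B) * x := by
    calc A ^ 2 + (κ * δ * B) ^ 2
        = κ * (κ * δ) * ((inner ℂ (mulOp (.id ℝ) e) (mulOp (.id ℝ * w) ρ')).re
            + 2 * -(inner ℂ e (mulOp (.id ℝ * w) ρ)).re
            + -(inner ℂ (mulOp (.id ℝ) e') (mulOp (.id ℝ * w) ρ)).re)
          + 2 * (κ * δ) ^ 2 * -(inner ℂ (mulOp (.id ℝ) e) e').re := by linarith
      _ ≤ κ * (κ * δ) * (A * (δ * ‖ρ'‖) + 2 * (‖e‖ * (δ * ‖ρ‖)) + B * (δ * ‖ρ‖))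
          + 2 * (κ * δ) ^ 2 * (A * ‖e'‖) := by gcongr
      _ = κ * δ * A * (κ * δ * ‖ρ'‖) + 2 * (κ * δ) ^ 2 * (‖e‖ * ‖ρ‖) + (κ * δ) ^ 2 * B * ‖ρ‖
          + 2 * (κ * δ) * A * (κ * δ * ‖e'‖) := by ring
      _ ≤ κ * δ * A * ‖θ‖ + 2 * (κ * δ) ^ 2 * ((κ * ‖θ‖) * ‖θ‖) + (κ * δ) ^ 2 * B * ‖θ‖
          + 2 * (κ * δ) * A * (κ * ‖θ‖) := by
        gcongr
        exact (h.norm_e_le hκ hδ hw2).1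
      _ = _ := by rw [hx]; ring
  have k1 : κ * (A * x) ≤ 1 / 36 * (A * x) := by gcongr
  have k2 : κ * x ^ 2 ≤ 1 / 36 * x ^ 2 := by gcongr
  by_contra! hlt
  nlinarith [sq_nonneg (2 * (κ * δ * B) - x)]

/-- The two weak equations are tested crosswise, with `y² e` and `y² ρ`, and subtracted. On the
right, `w` against `y² ρ` cancels except where the derivative hits `y²`, which leaves `-2κε⟨yρ,
wρ⟩`, negative since `y w = δ q`. The remainder comes from the derivative of `y²` in the two
Dirichlet forms. -/
theorem re_inner_transport (h : IsMollifiedCommutator δ κ w θ ρ ρ' e e')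
    {q : C(ℝ, ℝ)} (hq : .id ℝ * w = δ • q) :
    (inner ℂ e (mulOp (.id ℝ) (mulOp (.id ℝ) θ))).re =
      -2 * (κ * δ) ^ 2 * (inner ℂ ρ (mulOp q ρ)).re
      + 2 * (κ * δ) ^ 2 * (2 * (inner ℂ (mulOp (.id ℝ) e) ρ').re + (inner ℂ ρ e).re) := by
  have h1 := h.re_eq_rho h.h10_e.mulOp_sq
  have h2 := h.re_eq_e h.h10_rho.mulOp_sq
  have h3 := congrArg Complex.re (h.h10_rho.mulOp_id.inner_add_inner h.h10_e)
  have s1 := re_inner_symm e (mulOp (.id ℝ) (mulOp (.id ℝ) ρ))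
  have s2 := re_inner_symm e' (mulOp (.id ℝ) (mulOp (.id ℝ) ρ'))
  have s3 : (inner ℂ ρ (mulOp (.id ℝ) (mulOp (.id ℝ) (mulOp w ρ')))).re =
      (inner ℂ ρ' (mulOp (.id ℝ) (mulOp (.id ℝ) (mulOp w ρ)))).re := by
    simp only [mulOp_mulOp]
    rw [re_inner_symm, inner_mulOp_left]
  have s5 := re_inner_symm (mulOp (.id ℝ) e) ρ'
  have s4 : (inner ℂ ρ (mulOp (.id ℝ) (mulOp w ρ))).re = δ * (inner ℂ ρ (mulOp q ρ)).re := by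
    rw [mulOp_mulOp, hq, mulOp_smul, inner_smul_right, Complex.re_ofReal_mul]
  simp only [inner_add_left, inner_smul_left, inner_mulOp_left, Complex.add_re] at h1 h2 h3 s1 s2
  rw [conj_two] at h1 h2
  simp only [Complex.re_ofReal_mul, Complex.zero_re] at h1 h2 h3
  rw [inner_mulOp_left] at s5 ⊢
  rw [s3, s4] at h2
  rw [← h1, s1, s2]
  linear_combination (norm := ring_nf) h2 - 2 * (κ * δ) ^ 2 * h3 - 2 * (κ * δ) ^ 2 * s5

end IsMollifiedCommutator

/-- The main term `-Φ` controls `-‖θ‖²/12` up to `δ²‖D‖²`, by the uncertainty principle for `ρ` and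
the bound on `ρ - θ`. The remainders carry an extra `κ`; at `κ = 1/36` they leave at least half of
that coefficient, `1/24`. -/
theorem IsMollifiedCommutator.transport_le {δ κ : ℝ} {w q : C(ℝ, ℝ)} {θ D ρ ρ' e e' : L2I}
    (h : IsMollifiedCommutator δ κ w θ ρ ρ' e e') (hθ : IsH10Deriv θ D)
    (hδ : 0 < δ) (hκ : κ = 1 / 36)
    (hw : ∀ y, w y = δ * y / (δ ^ 2 + y ^ 2)) (hq : ∀ y, q y = y ^ 2 / (δ ^ 2 + y ^ 2)) :
    2 * (inner ℂ e (mulOp (.id ℝ) (mulOp (.id ℝ) θ))).re ≤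
      κ ^ 2 * (-(δ ^ 2 * ‖θ‖ ^ 2) / 6 + 5 * δ ^ 4 * ‖D‖ ^ 2) := by
  have hκ0 : 0 ≤ κ := by rw [hκ]; norm_num
  have hpos : ∀ y : ℝ, 0 < δ ^ 2 + y ^ 2 := fun y => by positivity
  have hw2 : ∀ y, |w y| ≤ 1 / 2 := by
    intro y
    rw [hw, abs_div, abs_of_pos (hpos y), div_le_iff₀ (hpos y), abs_le]
    constructor <;> nlinarith [sq_nonneg (δ - y), sq_nonneg (δ + y)]
  have hwq : ContinuousMap.id ℝ * w = δ • q := by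
    ext y
    simp only [ContinuousMap.mul_apply, ContinuousMap.id_apply, ContinuousMap.smul_apply,
      smul_eq_mul, hw, hq]
    ring
  have hyw : ∀ y, |(ContinuousMap.id ℝ * w) y| ≤ δ := by
    intro y
    rw [hwq, ContinuousMap.smul_apply, smul_eq_mul, hq, abs_of_nonneg (by positivity)]
    refine mul_le_of_le_one_right hδ.le ?_
    rw [div_le_one (hpos y)]
    nlinarith
  have hε : 0 < κ * δ := mul_pos (by rw [hκ]; norm_num) hδ
  have hX := h.re_inner_transport hwq
  have hye := h.norm_id_e_le hκ0 hδ.le hκ.le hw2 hyw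
  obtain ⟨hρD, hρθ⟩ := h.norm_rho_deriv_le_deriv hε hθ
  have hρ := h.norm_rho_le
  have he := (h.norm_e_le hκ0 hδ.le hw2).1
  have hu := h.h10_rho.norm_sq_le_weighted hδ hq hw hw2
  have b1 : (inner ℂ (mulOp (.id ℝ) e) ρ').re ≤ 3 * (κ * δ * ‖θ‖) * ‖D‖ :=
    (le_abs_self _).trans ((abs_re_inner_le _ _).trans (by gcongr))
  have b2 : (inner ℂ ρ e).re ≤ ‖θ‖ * (κ * ‖θ‖) :=
    (le_abs_self _).trans ((abs_re_inner_le _ _).trans (by gcongr))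
  set Φ := (inner ℂ ρ (mulOp q ρ)).re
  set N := ‖θ‖
  set d := ‖D‖
  have hN : 0 ≤ N := norm_nonneg _
  have hd : 0 ≤ d := norm_nonneg _
  have hNρ : N ≤ ‖ρ‖ + κ * δ * d := by
    have := norm_sub_norm_le θ ρ
    rw [norm_sub_rev] at this
    linarith
  have hu2 : ‖ρ‖ ^ 2 ≤ 6 * Φ + δ ^ 2 * d ^ 2 := by
    have : δ * (‖ρ‖ * ‖ρ'‖) ≤ ‖ρ‖ * (δ * d) := by
      calc δ * (‖ρ‖ * ‖ρ'‖) ≤ δ * (‖ρ‖ * d) := by gcongr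
        _ = _ := by ring
    nlinarith [sq_nonneg (‖ρ‖ - δ * d)]
  have hN2 : N ^ 2 ≤ 12 * Φ + 3 * (δ ^ 2 * d ^ 2) := by
    have e1 : N ^ 2 ≤ (‖ρ‖ + κ * δ * d) ^ 2 := by gcongr
    have e2 : (κ * δ * d) ^ 2 = 1 / 1296 * (δ ^ 2 * d ^ 2) := by rw [hκ]; ring
    nlinarith [sq_nonneg (‖ρ‖ - κ * δ * d), mul_nonneg (sq_nonneg δ) (sq_nonneg d)]
  rw [hX]
  have hc : 0 ≤ (κ * δ) ^ 2 := by positivity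
  have e1 : 2 * (inner ℂ (mulOp (.id ℝ) e) ρ').re + (inner ℂ ρ e).re ≤
      6 * (κ * δ * N * d) + κ * N ^ 2 := by linarith
  have e2 : κ * δ * N * d ≤ κ * (N ^ 2 / 24 + 6 * (δ ^ 2 * d ^ 2)) := by
    have : δ * N * d ≤ N ^ 2 / 24 + 6 * (δ ^ 2 * d ^ 2) := by
      nlinarith [sq_nonneg (N - 12 * (δ * d))]
    calc κ * δ * N * d = κ * (δ * N * d) := by ring
      _ ≤ _ := by gcongr
  calc 2 * (-2 * (κ * δ) ^ 2 * Φ + 2 * (κ * δ) ^ 2 *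
        (2 * (inner ℂ (mulOp (.id ℝ) e) ρ').re + (inner ℂ ρ e).re))
      = 4 * (κ * δ) ^ 2 * (-Φ + (2 * (inner ℂ (mulOp (.id ℝ) e) ρ').re + (inner ℂ ρ e).re)) := by
        ring
    _ ≤ 4 * (κ * δ) ^ 2 * (-(N ^ 2) / 24 + 5 / 4 * (δ ^ 2 * d ^ 2)) := by
        refine mul_le_mul_of_nonneg_left ?_ (by positivity)
        rw [hκ] at e1 e2
        nlinarith [mul_nonneg (sq_nonneg δ) (sq_nonneg d), sq_nonneg N]
    _ = _ := by ring

/-! ### Construction of the commutator from orthogonal projections. -/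

/-- The Hilbert space `L² × L²`. -/
abbrev L2Pair : Type := WithLp 2 (L2I × L2I)

/-- `(a, b) ↦ (κ w b, -κ w a)`. -/
noncomputable def rotateOp (κ : ℝ) (w : C(ℝ, ℝ)) : L2Pair →L[ℂ] L2Pair :=
  (WithLp.prodContinuousLinearEquiv 2 ℂ L2I L2I).symm.toContinuousLinearMap ∘L
    (((κ : ℂ) • (mulOp w ∘L WithLp.sndL 2 ℂ L2I L2I)).prod
      (-((κ : ℂ) • (mulOp w ∘L WithLp.fstL 2 ℂ L2I L2I))))

theorem rotateOp_fst (κ : ℝ) (w : C(ℝ, ℝ)) (x : L2Pair) :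
    (rotateOp κ w x).fst = (κ : ℂ) • mulOp w x.snd := rfl

theorem rotateOp_snd (κ : ℝ) (w : C(ℝ, ℝ)) (x : L2Pair) :
    (rotateOp κ w x).snd = -((κ : ℂ) • mulOp w x.fst) := rfl

theorem inner_L2Pair (x y : L2Pair) :
    inner ℂ x y = inner ℂ x.fst y.fst + inner ℂ x.snd y.snd := WithLp.prod_inner_apply x y

theorem inner_rotateOp (κ : ℝ) (w : C(ℝ, ℝ)) (x y : L2Pair) :
    inner ℂ (rotateOp κ w x) y = -inner ℂ x (rotateOp κ w y) := by
  simp only [inner_L2Pair, rotateOp_fst, rotateOp_snd, inner_smul_left,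
    inner_smul_right, inner_neg_left, inner_neg_right, inner_mulOp_left, Complex.conj_ofReal]
  ring

/-- The embedding `θ ↦ (θ, 0)`. -/
noncomputable def inlOp : L2I →L[ℂ] L2Pair :=
  (WithLp.prodContinuousLinearEquiv 2 ℂ L2I L2I).symm.toContinuousLinearMap ∘L
    ContinuousLinearMap.inl ℂ L2I L2I

theorem inlOp_fst (θ : L2I) : (inlOp θ).fst = θ := rfl

theorem inlOp_snd (θ : L2I) : (inlOp θ).snd = 0 := rfl

/-- `θ ↦ (e, ε e')` where `e = [(1 - ε² ∂_y²)⁻¹, W] θ` is the mollified commutator. -/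
noncomputable def commutatorLift (ε κ : ℝ) (w : C(ℝ, ℝ)) : L2I →L[ℂ] L2Pair :=
  (scaledH10 ε).starProjection ∘L rotateOp κ w ∘L (scaledH10 ε).starProjection ∘L inlOp

/-- The mollified commutator as an operator on `L²(-1, 1)`. -/
noncomputable def commutatorOp (ε κ : ℝ) (w : C(ℝ, ℝ)) : L2I →L[ℂ] L2I :=
  WithLp.fstL 2 ℂ L2I L2I ∘L commutatorLift ε κ w

/-- The operator has the form `ι* P J P ι` with `P` an orthogonal projection, `J = rotateOp κ w`
skew-adjoint and `ι = inlOp`. -/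
theorem inner_commutatorOp (ε κ : ℝ) (w : C(ℝ, ℝ)) (χ θ : L2I) :
    inner ℂ (commutatorOp ε κ w χ) θ = -inner ℂ χ (commutatorOp ε κ w θ) := by
  have h1 : ∀ x : L2Pair, ∀ f : L2I, inner ℂ x.fst f = inner ℂ x (inlOp f) := by
    intro x f
    rw [inner_L2Pair, inlOp_fst, inlOp_snd, inner_zero_right, add_zero]
  have h2 : ∀ x : L2Pair, ∀ f : L2I, inner ℂ f x.fst = inner ℂ (inlOp f) x := by
    intro x f
    rw [inner_L2Pair, inlOp_fst, inlOp_snd, inner_zero_left, add_zero]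
  change inner ℂ (commutatorLift ε κ w χ).fst θ = -inner ℂ χ (commutatorLift ε κ w θ).fst
  rw [h1, h2]
  simp only [commutatorLift, ContinuousLinearMap.comp_apply]
  rw [(scaledH10 ε).inner_starProjection_left_eq_right, inner_rotateOp,
    (scaledH10 ε).inner_starProjection_left_eq_right]

theorem isMollifiedCommutator_commutatorLift {δ κ : ℝ} (hε : κ * δ ≠ 0) (w : C(ℝ, ℝ)) (θ : L2I) :
    IsMollifiedCommutator δ κ w θ ((scaledH10 (κ * δ)).starProjection (inlOp θ)).fst
      (((κ * δ : ℝ)⁻¹ : ℂ) • ((scaledH10 (κ * δ)).starProjection (inlOp θ)).snd)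
      (commutatorOp (κ * δ) κ w θ)
      (((κ * δ : ℝ)⁻¹ : ℂ) • (commutatorLift (κ * δ) κ w θ).snd) := by
  set ε := κ * δ with hεd
  have hi : (ε : ℂ)⁻¹ * ε = 1 := inv_mul_cancel₀ (by exact_mod_cast hε)
  -- The variational characterisation of the projection: `P z` and `z` pair equally with every `(φ,
  -- εφ')` in the subspace.
  have var : ∀ (z : L2Pair) (φ φ' : L2I), IsH10Deriv φ φ' →
      inner ℂ φ ((scaledH10 ε).starProjection z).fst
        + (ε : ℂ) * inner ℂ φ' ((scaledH10 ε).starProjection z).snd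
      = inner ℂ φ z.fst + (ε : ℂ) * inner ℂ φ' z.snd := by
    intro z φ φ' h
    have h1 := (scaledH10 ε).inner_starProjection_left_eq_right
      (WithLp.toLp 2 (φ, (ε : ℂ) • φ')) z
    rw [(scaledH10 ε).starProjection_eq_self_iff.2 (mem_scaledH10 hε h)] at h1
    rw [inner_L2Pair, inner_L2Pair] at h1
    simp only [WithLp.toLp_fst, WithLp.toLp_snd, inner_smul_left, Complex.conj_ofReal] at h1
    exact h1.symm
  refine ⟨(scaledH10 ε).starProjection_apply_mem _, (scaledH10 ε).starProjection_apply_mem _,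
    fun φ φ' h => ?_, fun φ φ' h => ?_⟩
  · have := var (inlOp θ) φ φ' h
    rw [inlOp_fst, inlOp_snd, inner_zero_right, mul_zero, add_zero] at this
    rw [← this, inner_smul_right, ← hεd]
    push_cast
    linear_combination (ε : ℂ) * inner ℂ φ' ((scaledH10 ε).starProjection (inlOp θ)).snd * hi
  · have := var (rotateOp κ w ((scaledH10 ε).starProjection (inlOp θ))) φ φ' h
    rw [rotateOp_fst, rotateOp_snd, inner_neg_right, inner_smul_right, inner_smul_right] at this
    rw [map_smul, inner_smul_right, inner_smul_right, ← hεd]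
    push_cast
    change inner ℂ φ (commutatorLift ε κ w θ).fst
      + (ε : ℂ) * inner ℂ φ' (commutatorLift ε κ w θ).snd = _ at this
    change inner ℂ φ (commutatorLift ε κ w θ).fst + _ = _
    linear_combination this + ((ε : ℂ) * inner ℂ φ' (commutatorLift ε κ w θ).snd
      - κ * inner ℂ φ (mulOp w ((scaledH10 ε).starProjection (inlOp θ)).snd)) * hi

/-! ### Correlations of square integrable functions under time shifts. -/

section Translation

variable {K : Type*} [NormedAddCommGroup K] [InnerProductSpace ℂ K]

theorem integrable_inner_of_memLp {α : Type*} [MeasurableSpace α] {ν : Measure α} {f g : α → K}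
    (hf : MemLp f 2 ν) (hg : MemLp g 2 ν) : Integrable (fun x => inner ℂ (f x) (g x)) ν := by
  refine (L2.integrable_inner (𝕜 := ℂ) hf.toLp hg.toLp).congr ?_
  filter_upwards [hf.coeFn_toLp, hg.coeFn_toLp] with x h1 h2
  rw [h1, h2]

/-- The correlation `∫_0^T Re ⟪ψ(t) + ψ(t + h), f(t + r)⟫ dt` of square integrable functions depends
continuously on the shifts `h` and `r`. -/
theorem exists_continuous_correlation {ψ f : ℝ → K} (hψ : MemLp ψ 2 volume)
    (hf : MemLp f 2 volume) (T : ℝ) :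
    ∃ J : ℝ → ℝ → ℝ, Continuous (fun p : ℝ × ℝ => J p.1 p.2) ∧
      ∀ h r, J h r = ∫ t in Ioo 0 T, (inner ℂ (ψ t + ψ (t + h)) (f (r + t))).re := by
  have : Fact ((2 : ℝ≥0∞) ≠ ∞) := ⟨by norm_num⟩
  let S := LpToLpRestrictCLM ℝ K ℂ volume 2 (Ioo 0 T)
  -- Strong continuity of translations in `L²`.
  have hc : ∀ g : Lp K 2 (volume : Measure ℝ), Continuous fun h : ℝ =>
      (DomAddAct.mk h +ᵥ g : Lp K 2 (volume : Measure ℝ)) := fun g =>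
    (DomAddAct.continuous_mk).vadd continuous_const
  refine ⟨fun h r => (inner ℂ (S (hψ.toLp + (DomAddAct.mk h +ᵥ hψ.toLp)))
    (S (DomAddAct.mk r +ᵥ hf.toLp))).re, ?_, fun h r => ?_⟩
  · refine Complex.continuous_re.comp (Continuous.inner ?_ ?_)
    · exact S.continuous.comp (continuous_const.add ((hc _).comp continuous_fst))
    · exact S.continuous.comp ((hc _).comp continuous_snd)
  · beta_reduce
    rw [L2.inner_def, ← RCLike.re_eq_complex_re, ← integral_re (L2.integrable_inner _ _)]
    refine integral_congr_ae ?_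
    have t1 : ∀ c : ℝ, ∀ {g : ℝ → K} (hg : MemLp g 2 volume),
        (DomAddAct.mk c +ᵥ hg.toLp : Lp K 2 (volume : Measure ℝ)) =ᵐ[volume]
          fun t => g (c + t) := by
      intro c g hg
      refine (DomAddAct.vadd_Lp_ae_eq (DomAddAct.mk c) hg.toLp).trans ?_
      exact (measurePreserving_add_left volume c).quasiMeasurePreserving.ae hg.coeFn_toLp
    filter_upwards [LpToLpRestrictCLM_coeFn ℂ (Ioo 0 T) (hψ.toLp + (DomAddAct.mk h +ᵥ hψ.toLp)),
      LpToLpRestrictCLM_coeFn ℂ (Ioo 0 T) (DomAddAct.mk r +ᵥ hf.toLp),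
      ae_restrict_of_ae (t1 h hψ), ae_restrict_of_ae (t1 r hf), ae_restrict_of_ae hψ.coeFn_toLp,
      ae_restrict_of_ae (Lp.coeFn_add hψ.toLp (DomAddAct.mk h +ᵥ hψ.toLp))] with t h1 h2 h3 h4 h5 h6
    rw [h1, h2, h4, h6, Pi.add_apply, h3, h5, add_comm h t]

/-- Fubini's theorem for averaged correlations. -/
theorem integral_correlation_swap {ψ f : ℝ → K} (hψ : MemLp ψ 2 volume)
    (hf : MemLp f 2 volume) (T h : ℝ) :
    ∫ r in Ioo 0 h, ∫ t in Ioo 0 T, (inner ℂ (ψ t + ψ (t + h)) (f (r + t))).re =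
      ∫ t in Ioo 0 T, ∫ r in Ioo 0 h, (inner ℂ (ψ t + ψ (t + h)) (f (r + t))).re := by
  refine integral_integral_swap ?_
  have h1 : MemLp (fun t => ψ t + ψ (t + h)) 2 volume :=
    hψ.add (hψ.comp_measurePreserving (measurePreserving_add_right volume h))
  have h2 := h1.comp_snd (volume.restrict (Ioo 0 h))
  -- The shear `(r, t) ↦ (r, r + t)` preserves the product measure.
  have h3 := (hf.comp_snd (volume.restrict (Ioo 0 h))).comp_measurePreserving
    (measurePreserving_prod_add (volume.restrict (Ioo 0 h)) volume)
  have h4 := (integrable_inner_of_memLp h2 h3).re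
  exact h4.mono_measure (Measure.prod_mono le_rfl Measure.restrict_le_self)

end Translation

/-! ### The energy identity for weak solutions. -/

section EnergyIdentity

variable {H K : Type*} [NormedAddCommGroup H] [InnerProductSpace ℂ H]
  [NormedAddCommGroup K] [InnerProductSpace ℂ K]

/-- The increment of the quadratic form is written with both endpoints as test vectors, so no
quadratic remainder in `y - x` appears. -/
theorem re_quadratic_sub (B : H →L[ℂ] H) (hB : ∀ x y, inner ℂ (B x) y = inner ℂ x (B y))
    (x y : H) : (inner ℂ (B y) y).re - (inner ℂ (B x) x).re =
      (inner ℂ (B x) (y - x)).re + (inner ℂ (B y) (y - x)).re := by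
  have h1 : (inner ℂ (B x) y).re = (inner ℂ (B y) x).re := by
    rw [hB x y]
    exact inner_re_symm (𝕜 := ℂ) _ _
  simp only [inner_sub_right, Complex.sub_re, h1]
  ring

/-- The energy identity (Lions–Magenes) for a quadratic form given by a bounded self-adjoint
operator `B`: if `⟪B θ(t), θ(s') - θ(s)⟫ = ∫_s^{s'} ⟪Ψ(t), F⟫` for almost every `t`, then
`d/dt ⟪B θ, θ⟫ = 2 Re ⟪Ψ, F⟫` in integrated form. -/
theorem energy_identity {θ : ℝ → H} (hθ : ContinuousOn θ (Ici 0)) (B : H →L[ℂ] H)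
    (hB : ∀ x y, inner ℂ (B x) y = inner ℂ x (B y)) {Ψ F : ℝ → K}
    (hΨ : ∀ T : ℝ, 0 < T → MemLp Ψ 2 (volume.restrict (Ioo 0 T)))
    (hF : ∀ T : ℝ, 0 < T → MemLp F 2 (volume.restrict (Ioo 0 T)))
    (hweak : ∀ᵐ t ∂volT, ∀ s s' : ℝ, 0 ≤ s → s ≤ s' →
      inner ℂ (B (θ t)) (θ s' - θ s) = ∫ r in s..s', inner ℂ (Ψ t) (F r))
    {T : ℝ} (hT : 0 < T) :
    (inner ℂ (B (θ T)) (θ T)).re - (inner ℂ (B (θ 0)) (θ 0)).re =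
      ∫ t in Ioo 0 T, 2 * (inner ℂ (Ψ t) (F t)).re := by
  let q : ℝ → ℝ := fun t => (inner ℂ (B (θ t)) (θ t)).re
  have hq : ContinuousOn q (Ici 0) :=
    Complex.continuous_re.comp_continuousOn ((B.continuous.comp_continuousOn hθ).inner hθ)
  -- Extension by zero makes translations act on `L²(ℝ)`; the margin 1 accommodates shifts `h < 1`.
  let ψ := (Ioo 0 (T + 1)).indicator Ψ
  let f := (Ioo 0 (T + 1)).indicator F
  have hψ : MemLp ψ 2 volume :=
    (memLp_indicator_iff_restrict measurableSet_Ioo).2 (hΨ _ (by linarith))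
  have hf : MemLp f 2 volume :=
    (memLp_indicator_iff_restrict measurableSet_Ioo).2 (hF _ (by linarith))
  obtain ⟨J, hJc, hJ⟩ := exists_continuous_correlation hψ hf T
  have hJ0 : J 0 0 = ∫ t in Ioo 0 T, 2 * (inner ℂ (Ψ t) (F t)).re := by
    rw [hJ]
    refine setIntegral_congr_fun measurableSet_Ioo fun t ht => ?_
    have ht' : t ∈ Ioo 0 (T + 1) := ⟨ht.1, by linarith [ht.2]⟩
    simp only [ψ, f, add_zero, zero_add, indicator_of_mem ht', inner_add_left, Complex.add_re]
    ring
  -- the averaged identity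
  have avg : ∀ h : ℝ, 0 < h → h < 1 →
      ∫ r in (0 : ℝ)..h, J h r = ∫ r in (0 : ℝ)..h, (q (T + r) - q r) := by
    intro h h0 h1
    have e1 : ∫ r in (0 : ℝ)..h, J h r = ∫ r in Ioo 0 h, ∫ t in Ioo 0 T,
        (inner ℂ (ψ t + ψ (t + h)) (f (r + t))).re := by
      rw [intervalIntegral.integral_of_le h0.le, integral_Ioc_eq_integral_Ioo]
      simp only [hJ]
    have hweak' : ∀ᵐ t ∂(volume.restrict (Ioo 0 T)), ∀ s s' : ℝ, 0 ≤ s → s ≤ s' →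
        inner ℂ (B (θ (t + h))) (θ s' - θ s) = ∫ r in s..s', inner ℂ (Ψ (t + h)) (F r) := by
      have := (ae_restrict_iff' measurableSet_Ioi).1 hweak
      have := (measurePreserving_add_right volume h).quasiMeasurePreserving.ae this
      filter_upwards [ae_restrict_of_ae this, ae_restrict_mem measurableSet_Ioo] with t ht ht'
      exact ht (add_pos ht'.1 h0)
    have e2 : ∫ t in Ioo 0 T, ∫ r in Ioo 0 h, (inner ℂ (ψ t + ψ (t + h)) (f (r + t))).re =
        ∫ t in Ioo 0 T, (q (t + h) - q t) := by
      refine integral_congr_ae ?_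
      have hres : volume.restrict (Ioo 0 T) ≤ volT :=
        Measure.restrict_mono Ioo_subset_Ioi_self le_rfl
      filter_upwards [ae_mono hres hweak, hweak', ae_restrict_mem measurableSet_Ioo]
        with t w1 w2 ht
      have m1 : t ∈ Ioo 0 (T + 1) := ⟨ht.1, by linarith [ht.2]⟩
      have m2 : t + h ∈ Ioo 0 (T + 1) := ⟨by linarith [ht.1], by linarith [ht.2]⟩
      have hFi : IntegrableOn F (Ioo 0 (T + 1)) volume :=
        (hF _ (by linarith)).integrable (by norm_num)
      have hFt : IntervalIntegrable F volume t (t + h) := by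
        rw [intervalIntegrable_iff_integrableOn_Ioo_of_le (by linarith)]
        exact hFi.mono_set fun x hx => ⟨ht.1.trans hx.1, hx.2.trans m2.2⟩
      have hin : ∀ v : K, IntervalIntegrable (fun r => inner ℂ v (F r)) volume t (t + h) :=
        fun v => ⟨hFt.1.const_inner v, hFt.2.const_inner v⟩
      have e3 : q (t + h) - q t =
          (∫ r in t..t + h, inner ℂ (Ψ t + Ψ (t + h)) (F r)).re := by
        simp only [q]
        rw [re_quadratic_sub B hB, w1 t (t + h) ht.1.le (by linarith),
          w2 t (t + h) ht.1.le (by linarith), ← Complex.add_re,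
          ← intervalIntegral.integral_add (hin _) (hin _)]
        simp only [inner_add_left]
      have e4 : (∫ r in t..t + h, inner ℂ (Ψ t + Ψ (t + h)) (F r)).re =
          ∫ r in t..t + h, (inner ℂ (Ψ t + Ψ (t + h)) (F r)).re := by
        rw [intervalIntegral.integral_of_le (by linarith),
          intervalIntegral.integral_of_le (by linarith)]
        exact (integral_re (hin _).1).symm
      rw [e3, e4, ← integral_Ioc_eq_integral_Ioo, ← intervalIntegral.integral_of_le h0.le]
      rw [intervalIntegral.integral_comp_add_right
        (fun r => (inner ℂ (ψ t + ψ (t + h)) (f r)).re), zero_add, add_comm h t,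
        intervalIntegral.integral_of_le (by linarith),
        intervalIntegral.integral_of_le (by linarith), integral_Ioc_eq_integral_Ioo,
        integral_Ioc_eq_integral_Ioo]
      refine setIntegral_congr_fun measurableSet_Ioo fun r hr => ?_
      have m3 : r ∈ Ioo 0 (T + 1) := ⟨ht.1.trans hr.1, hr.2.trans m2.2⟩
      simp only [ψ, f, indicator_of_mem m1, indicator_of_mem m2, indicator_of_mem m3]
    have qi : ∀ a b : ℝ, 0 ≤ a → 0 ≤ b → IntervalIntegrable q volume a b := fun a b ha hb =>
      (hq.mono fun x hx => (le_min ha hb).trans hx.1).intervalIntegrable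
    rw [e1, integral_correlation_swap hψ hf, e2, ← integral_Ioc_eq_integral_Ioo,
      ← intervalIntegral.integral_of_le hT.le, intervalIntegral.integral_sub _ (qi 0 T le_rfl hT.le),
      intervalIntegral.integral_sub _ (qi 0 h le_rfl h0.le),
      intervalIntegral.integral_comp_add_right q, intervalIntegral.integral_comp_add_left q]
    -- Telescoping: `∫_0^T (q(t + h) - q(t)) dt` leaves only the end strips of width `h`.
    · have a1 := intervalIntegral.integral_add_adjacent_intervals
        (qi 0 h le_rfl h0.le) (qi h (T + h) h0.le (by linarith))
      have a2 := intervalIntegral.integral_add_adjacent_intervals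
        (qi 0 T le_rfl hT.le) (qi T (T + h) hT.le (by linarith))
      rw [zero_add, add_zero]
      linarith
    · have := (qi (T + 0) (T + h) (by linarith) (by linarith)).comp_add_left T
      simpa using this
    · have := (qi (0 + h) (T + h) (by linarith) (by linarith)).comp_add_right h
      simpa using this
  rw [← hJ0]
  change q T - q 0 = J 0 0
  refine eq_of_forall_dist_le fun η hη => ?_
  -- continuity at the origin
  have c1 : ∀ᶠ r in nhdsWithin (0 : ℝ) (Ici 0), |q (T + r) - q T| < η / 3 := by
    have hc : ContinuousWithinAt (fun r => q (T + r)) (Ici 0) 0 := by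
      refine ContinuousWithinAt.comp (g := q) (f := fun r => T + r) (t := Ici 0) ?_ ?_ ?_
      · simpa using hq T hT.le
      · fun_prop
      · exact fun r hr => add_nonneg hT.le hr
    have := Metric.tendsto_nhds.1 hc (η / 3) (by linarith)
    simpa [Real.dist_eq] using this
  have c2 : ∀ᶠ r in nhdsWithin (0 : ℝ) (Ici 0), |q r - q 0| < η / 3 := by
    have := Metric.tendsto_nhds.1 (hq 0 self_mem_Ici) (η / 3) (by linarith)
    simpa [Real.dist_eq] using this
  obtain ⟨ε1, hε1, H1⟩ := Metric.mem_nhdsWithin_iff.1 (c1.and c2)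
  obtain ⟨ε2, hε2, H2⟩ := Metric.continuous_iff.1 hJc (0, 0) (η / 3) (by linarith)
  obtain ⟨h, h0, hlt⟩ : ∃ h : ℝ, 0 < h ∧ h < min 1 (min ε1 ε2) :=
    exists_between (lt_min one_pos (lt_min hε1 hε2))
  have hh1 : h < 1 := hlt.trans_le (min_le_left _ _)
  have hhε1 : h < ε1 := hlt.trans_le ((min_le_right _ _).trans (min_le_left _ _))
  have hhε2 : h < ε2 := hlt.trans_le ((min_le_right _ _).trans (min_le_right _ _))
  have hJi : IntervalIntegrable (J h) volume 0 h :=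
    (hJc.comp (continuous_const.prodMk continuous_id)).intervalIntegrable _ _
  have hqi : IntervalIntegrable (fun r => q (T + r) - q r) volume 0 h := by
    refine ContinuousOn.intervalIntegrable ?_
    rw [uIcc_of_le h0.le]
    exact (hq.comp (by fun_prop) fun r hr => add_nonneg hT.le hr.1).sub
      (hq.mono fun r hr => hr.1)
  -- By `avg` the second summand has zero integral over `(0, h)`, so the integral is `h` times the
  -- constant to be estimated, while the integrand is at most `η`.
  have bound := intervalIntegral.norm_integral_le_of_norm_le_const (a := (0 : ℝ)) (b := h) (C := η)
    (f := fun r => (q T - q 0 - J 0 0) + (J h r - (q (T + r) - q r))) (by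
      intro r hr
      rw [uIoc_of_le h0.le] at hr
      have hr0 : |r| = r := abs_of_pos hr.1
      obtain ⟨b1, b2⟩ := H1 (show r ∈ Metric.ball 0 ε1 ∩ Ici 0 from
        ⟨by rw [Metric.mem_ball, Real.dist_eq, sub_zero, hr0]; linarith [hr.2], hr.1.le⟩)
      have b3 := H2 (h, r) (by
        rw [Prod.dist_eq, Real.dist_eq, Real.dist_eq, sub_zero, sub_zero, hr0, abs_of_pos h0]
        exact max_lt hhε2 (by linarith [hr.2]))
      rw [Real.dist_eq] at b3
      rw [Real.norm_eq_abs]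
      rw [abs_lt] at b1 b2 b3
      rw [abs_le]
      dsimp only at b3
      constructor <;> linarith)
  rw [intervalIntegral.integral_add (by simp) (hJi.sub hqi),
    intervalIntegral.integral_sub hJi hqi, avg h h0 hh1, sub_self, add_zero,
    intervalIntegral.integral_const, sub_zero, smul_eq_mul, norm_mul, Real.norm_eq_abs h,
    mul_comm η] at bound
  exact le_of_mul_le_mul_left bound (abs_pos.2 h0.ne')

end EnergyIdentity

/-! ### The weak formulation as an evolution with bulk force and flux. -/

theorem intervalIntegrable_inner {v : ℝ → L2I} {T : ℝ} (hT : 0 ≤ T)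
    (hv : MemLp v 2 (volume.restrict (Ioo 0 T))) (φ : L2I) :
    IntervalIntegrable (fun r => inner ℂ φ (v r)) volume 0 T := by
  rw [intervalIntegrable_iff_integrableOn_Ioo_of_le hT]
  have h : Integrable v (volume.restrict (Ioo 0 T)) := hv.integrable (by norm_num)
  exact h.const_inner φ

theorem memLp_smul {v : ℝ → L2I} {ν : Measure ℝ} (hv : MemLp v 2 ν) (c : ℂ) :
    MemLp (fun t => c • v t) 2 ν := hv.const_smul c

theorem inner_toLp_pair (a b c d : L2I) :
    inner ℂ (WithLp.toLp 2 (a, b) : L2Pair) (WithLp.toLp 2 (c, d)) = inner ℂ a c + inner ℂ b d :=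
  inner_L2Pair _ _

/-- The part of the right-hand side of the equation for `∂_t θ` lying in `L²`. -/
noncomputable def bulkForce (μ : ℝ) (k : ℤ) (g₁ g₃ θ : L2I) : L2I :=
  -(((μ : ℂ) * (k : ℂ) ^ 2) • θ + (Complex.I * k) • (θ - mulOp (.id ℝ) (mulOp (.id ℝ) θ))
    + (Complex.I * k) • g₁ + g₃)

/-- The flux: the equation reads `∂_t θ = bulkForce - ∂_y fluxForce`. -/
noncomputable def fluxForce (μ : ℝ) (g₂ D : L2I) : L2I := g₂ - (μ : ℂ) • D

theorem flowPairing_eq_inner_sub (φ f : L2I) :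
    flowPairing φ f = inner ℂ φ (f - mulOp (.id ℝ) (mulOp (.id ℝ) f)) := by
  rw [flowPairing_eq φ f (1 + (-1 : ℝ) • (ContinuousMap.id ℝ * ContinuousMap.id ℝ)) (fun y => by
    simp; ring), mulOp_add, mulOp_one, mulOp_smul, ← mulOp_mulOp, sub_eq_add_neg]
  simp

namespace IsTempSolution

variable {μ : ℝ} {k : ℤ} {θ₀ : L2I} {g₁ g₂ g₃ θ Dθ : ℝ → L2I}

theorem memLp_theta (h : IsTempSolution μ k θ₀ g₁ g₂ g₃ θ Dθ) (T : ℝ) :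
    MemLp θ 2 (volume.restrict (Ioo 0 T)) := by
  have hc : ContinuousOn θ (Icc 0 T) := h.continuousOn.mono Icc_subset_Ici_self
  obtain ⟨C, hC⟩ := isCompact_Icc.exists_bound_of_continuousOn hc
  refine MemLp.of_bound ((hc.mono Ioo_subset_Icc_self).aestronglyMeasurable measurableSet_Ioo) C ?_
  filter_upwards [ae_restrict_mem measurableSet_Ioo] with t ht
  exact hC t (Ioo_subset_Icc_self ht)

theorem memLp_bulkForce (h : IsTempSolution μ k θ₀ g₁ g₂ g₃ θ Dθ) (h₁ : MemLp g₁ 2 volT)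
    (h₃ : MemLp g₃ 2 volT) (T : ℝ) :
    MemLp (fun t => bulkForce μ k (g₁ t) (g₃ t) (θ t)) 2 (volume.restrict (Ioo 0 T)) := by
  have hres : volume.restrict (Ioo 0 T) ≤ volT := Measure.restrict_mono Ioo_subset_Ioi_self le_rfl
  have hθ := h.memLp_theta T
  have hY : MemLp (fun t => mulOp (.id ℝ) (mulOp (.id ℝ) (θ t))) 2 (volume.restrict (Ioo 0 T)) :=
    (mulOp (.id ℝ)).comp_memLp' ((mulOp (.id ℝ)).comp_memLp' hθ)
  have s1 := memLp_smul hθ ((μ : ℂ) * (k : ℂ) ^ 2)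
  have s2 := memLp_smul (hθ.sub hY) (Complex.I * k)
  have s3 := memLp_smul (h₁.mono_measure hres) (Complex.I * k)
  exact (((s1.add s2).add s3).add (h₃.mono_measure hres)).neg

theorem memLp_fluxForce (h : IsTempSolution μ k θ₀ g₁ g₂ g₃ θ Dθ) (h₂ : MemLp g₂ 2 volT)
    {T : ℝ} (hT : 0 < T) :
    MemLp (fun t => fluxForce μ (g₂ t) (Dθ t)) 2 (volume.restrict (Ioo 0 T)) := by
  have hres : volume.restrict (Ioo 0 T) ≤ volT := Measure.restrict_mono Ioo_subset_Ioi_self le_rfl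
  exact (h₂.mono_measure hres).sub (memLp_smul (h.memLp_deriv T hT) μ)

theorem inner_sub_eq (h : IsTempSolution μ k θ₀ g₁ g₂ g₃ θ Dθ) (h₁ : MemLp g₁ 2 volT)
    (h₂ : MemLp g₂ 2 volT) (h₃ : MemLp g₃ 2 volT) {φ φ' : L2I} (hφ : IsH10Deriv φ φ')
    {s s' : ℝ} (hs : 0 ≤ s) (hss : s ≤ s') :
    inner ℂ φ (θ s' - θ s) = ∫ r in s..s',
      (inner ℂ φ (bulkForce μ k (g₁ r) (g₃ r) (θ r)) + inner ℂ φ' (fluxForce μ (g₂ r) (Dθ r))) := by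
  have hi : ∀ t : ℝ, 0 ≤ t → IntervalIntegrable (fun r =>
      inner ℂ φ (bulkForce μ k (g₁ r) (g₃ r) (θ r)) + inner ℂ φ' (fluxForce μ (g₂ r) (Dθ r)))
      volume 0 t := by
    intro t ht
    rcases ht.eq_or_lt with rfl | ht'
    · simp
    · exact (intervalIntegrable_inner ht (h.memLp_bulkForce h₁ h₃ t) φ).add
        (intervalIntegrable_inner ht (h.memLp_fluxForce h₂ ht') φ')
  have key : ∀ t : ℝ, 0 ≤ t → inner ℂ φ (θ t) - inner ℂ φ θ₀ = ∫ r in (0 : ℝ)..t,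
      (inner ℂ φ (bulkForce μ k (g₁ r) (g₃ r) (θ r)) + inner ℂ φ' (fluxForce μ (g₂ r) (Dθ r))) := by
    intro t ht
    rcases ht.eq_or_lt with rfl | ht'
    · simp [h.initial]
    have hres : volume.restrict (Ioo 0 t) ≤ volT :=
      Measure.restrict_mono Ioo_subset_Ioi_self le_rfl
    have i1 := intervalIntegrable_inner ht (h₁.mono_measure hres) φ
    have i2 := intervalIntegrable_inner ht (h₂.mono_measure hres) φ'
    have i3 := intervalIntegrable_inner ht (h₃.mono_measure hres) φ
    have iR : IntervalIntegrable (fun s => -(Complex.I * (k : ℂ) * inner ℂ φ (g₁ s))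
        + inner ℂ φ' (g₂ s) - inner ℂ φ (g₃ s)) volume 0 t :=
      (((i1.const_mul (Complex.I * (k : ℂ))).neg).add i2).sub i3
    have e : ∀ s, ((μ : ℂ) * ((k : ℂ) ^ 2 * inner ℂ φ (θ s) + inner ℂ φ' (Dθ s))
            + Complex.I * (k : ℂ) * flowPairing φ (θ s)) =
        (-(Complex.I * (k : ℂ) * inner ℂ φ (g₁ s)) + inner ℂ φ' (g₂ s) - inner ℂ φ (g₃ s))
        - (inner ℂ φ (bulkForce μ k (g₁ s) (g₃ s) (θ s))
          + inner ℂ φ' (fluxForce μ (g₂ s) (Dθ s))) := by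
      intro s
      rw [flowPairing_eq_inner_sub, bulkForce, fluxForce]
      simp only [inner_neg_right, inner_add_right, inner_sub_right, inner_smul_right]
      ring
    have hw := h.weak φ φ' hφ t ht
    simp only [e] at hw
    rw [intervalIntegral.integral_sub iR (hi t ht)] at hw
    linear_combination hw
  rw [← intervalIntegral.integral_interval_sub_left (hi s' (hs.trans hss)) (hi s hs),
    ← key s' (hs.trans hss), ← key s hs, inner_sub_right]
  ring

/-- The energy identity along a solution, for a bounded self-adjoint operator `B` such that
`B θ(t) ∈ H¹₀` with derivative `P t`. -/
theorem re_inner_sub_eq (h : IsTempSolution μ k θ₀ g₁ g₂ g₃ θ Dθ) (h₁ : MemLp g₁ 2 volT)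
    (h₂ : MemLp g₂ 2 volT) (h₃ : MemLp g₃ 2 volT) (B : L2I →L[ℂ] L2I)
    (hB : ∀ x y, inner ℂ (B x) y = inner ℂ x (B y)) {P : ℝ → L2I}
    (hP : ∀ T : ℝ, 0 < T → MemLp P 2 (volume.restrict (Ioo 0 T)))
    (hBP : ∀ᵐ t ∂volT, IsH10Deriv (B (θ t)) (P t)) {T : ℝ} (hT : 0 < T) :
    (inner ℂ (B (θ T)) (θ T)).re - (inner ℂ (B θ₀) θ₀).re = ∫ t in Ioo 0 T,
      2 * (inner ℂ (B (θ t)) (bulkForce μ k (g₁ t) (g₃ t) (θ t))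
        + inner ℂ (P t) (fluxForce μ (g₂ t) (Dθ t))).re := by
  have pair : ∀ {a b : ℝ → L2I} {T : ℝ}, MemLp a 2 (volume.restrict (Ioo 0 T)) →
      MemLp b 2 (volume.restrict (Ioo 0 T)) →
      MemLp (fun t => (WithLp.toLp 2 (a t, b t) : L2Pair)) 2 (volume.restrict (Ioo 0 T)) := by
    intro a b T ha hb
    have := (inlOp.comp_memLp' ha).add
      (((WithLp.prodContinuousLinearEquiv 2 ℂ L2I L2I).symm.toContinuousLinearMap ∘L
        ContinuousLinearMap.inr ℂ L2I L2I).comp_memLp' hb)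
    refine this.ae_eq (ae_of_all _ fun t => ?_)
    change WithLp.toLp 2 (a t + 0, 0 + b t) = _
    rw [add_zero, zero_add]
  have := energy_identity h.continuousOn B hB
    (Ψ := fun t => (WithLp.toLp 2 (B (θ t), P t) : L2Pair))
    (F := fun t => (WithLp.toLp 2 (bulkForce μ k (g₁ t) (g₃ t) (θ t),
      fluxForce μ (g₂ t) (Dθ t)) : L2Pair))
    (fun T hT => pair (B.comp_memLp' (h.memLp_theta T)) (hP T hT))
    (fun T hT => pair (h.memLp_bulkForce h₁ h₃ T) (h.memLp_fluxForce h₂ hT)) (by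
      filter_upwards [hBP] with t ht s s' hs hss
      rw [h.inner_sub_eq h₁ h₂ h₃ ht hs hss]
      simp only [inner_toLp_pair]) hT
  rw [h.initial] at this
  rw [this]
  simp only [inner_toLp_pair]

end IsTempSolution

/-! ### Differential inequalities and the augmented energy. -/

theorem im_inner_self_sub_sq (θ : L2I) :
    (inner ℂ θ (θ - mulOp (.id ℝ) (mulOp (.id ℝ) θ))).im = 0 := by
  rw [inner_sub_right, ← inner_mulOp_left, Complex.sub_im]
  have h : ∀ f : L2I, (inner ℂ f f : ℂ).im = 0 := fun f => inner_self_im (𝕜 := ℂ) f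
  rw [h, h, sub_zero]

/-- Transport drops out because `1 - y²` is real. Half of the dissipation pays for `g₁` and `g₂`;
the `g₃` term is kept, since its best bound also uses the enhanced dissipation. -/
theorem re_energy_le {μ : ℝ} (hμ : 0 < μ) (k : ℤ) (θ D g₁ g₂ g₃ : L2I) :
    2 * (inner ℂ θ (bulkForce μ k g₁ g₃ θ) + inner ℂ D (fluxForce μ g₂ D)).re ≤
      -(μ * |(k : ℝ)| ^ 2 * ‖θ‖ ^ 2) - μ * ‖D‖ ^ 2 + μ⁻¹ * (‖g₁‖ ^ 2 + ‖g₂‖ ^ 2)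
        + 2 * (‖θ‖ * ‖g₃‖) := by
  have e : (inner ℂ θ (bulkForce μ k g₁ g₃ θ) + inner ℂ D (fluxForce μ g₂ D)).re =
      -(μ * |(k : ℝ)| ^ 2 * ‖θ‖ ^ 2) + k * (inner ℂ θ g₁).im - (inner ℂ θ g₃).re
        + (inner ℂ D g₂).re - μ * ‖D‖ ^ 2 := by
    have h1 := im_inner_self_sub_sq θ
    have h2 : ((μ : ℂ) * (k : ℂ) ^ 2) = ((μ * (k : ℝ) ^ 2 : ℝ) : ℂ) := by push_cast; ring
    have h3 : Complex.I * (k : ℂ) = Complex.I * ((k : ℝ) : ℂ) := by push_cast; ring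
    rw [bulkForce, fluxForce, h2, h3, sq_abs]
    simp only [inner_neg_right, inner_add_right θ, inner_sub_right D, inner_smul_right,
      Complex.add_re, Complex.sub_re, Complex.neg_re, mul_assoc, Complex.I_mul_re,
      Complex.re_ofReal_mul, Complex.im_ofReal_mul, h1, re_inner_self]
    ring
  have b1 : k * (inner ℂ θ g₁).im ≤ |(k : ℝ)| * (‖θ‖ * ‖g₁‖) := by
    refine (le_abs_self _).trans ?_
    rw [abs_mul]
    gcongr
    exact (Complex.abs_im_le_norm _).trans (norm_inner_le_norm _ _)
  have b2 := (le_abs_self _).trans (abs_re_inner_le D g₂)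
  have b3 := (neg_le_abs _).trans (abs_re_inner_le θ g₃)
  have c1 : 2 * (|(k : ℝ)| * (‖θ‖ * ‖g₁‖)) ≤ μ * |(k : ℝ)| ^ 2 * ‖θ‖ ^ 2 + μ⁻¹ * ‖g₁‖ ^ 2 := by
    have h : 0 ≤ μ⁻¹ * (μ * |(k : ℝ)| * ‖θ‖ - ‖g₁‖) ^ 2 := by positivity
    have h' : μ⁻¹ * (μ * |(k : ℝ)| * ‖θ‖ - ‖g₁‖) ^ 2 =
        μ * |(k : ℝ)| ^ 2 * ‖θ‖ ^ 2 + μ⁻¹ * ‖g₁‖ ^ 2 - 2 * (|(k : ℝ)| * (‖θ‖ * ‖g₁‖)) := by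
      field_simp
      ring
    linarith
  have c2 : 2 * (‖D‖ * ‖g₂‖) ≤ μ * ‖D‖ ^ 2 + μ⁻¹ * ‖g₂‖ ^ 2 := by
    have h : 0 ≤ μ⁻¹ * (μ * ‖D‖ - ‖g₂‖) ^ 2 := by positivity
    have h' : μ⁻¹ * (μ * ‖D‖ - ‖g₂‖) ^ 2 =
        μ * ‖D‖ ^ 2 + μ⁻¹ * ‖g₂‖ ^ 2 - 2 * (‖D‖ * ‖g₂‖) := by
      field_simp
      ring
    linarith
  rw [e]
  linarith

/-- Against `iAθ` the constant part of `1 - y²` contributes nothing by `he0`, so transport reduces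
to `k Re⟨e, y²θ⟩`; the sign `σ` makes its main part dissipative for either sign of `k`. -/
theorem IsMollifiedCommutator.re_hypocoercive_le {δ κ : ℝ} {w q : C(ℝ, ℝ)}
    {θ D ρ ρ' e e' : L2I}
    (h : IsMollifiedCommutator δ κ w θ ρ ρ' e e') (hθ : IsH10Deriv θ D)
    (hδ : 0 < δ) (hκ : κ = 1 / 36)
    (hw : ∀ y, w y = δ * y / (δ ^ 2 + y ^ 2)) (hq : ∀ y, q y = y ^ 2 / (δ ^ 2 + y ^ 2))
    (he0 : (inner ℂ e θ).re = 0) {μ : ℝ} (hμ : 0 < μ) {k : ℤ} {σ : ℝ} (hσ : σ * k = |(k : ℝ)|)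
    (hσ1 : |σ| = 1) (g₁ g₂ g₃ : L2I) :
    σ * (2 * (inner ℂ (Complex.I • e) (bulkForce μ k g₁ g₃ θ)
        + inner ℂ (Complex.I • e') (fluxForce μ g₂ D)).re) ≤
      |(k : ℝ)| * (κ ^ 2 * (-(δ ^ 2 * ‖θ‖ ^ 2) / 6 + 5 * δ ^ 4 * ‖D‖ ^ 2))
        + 2 * (κ * ‖θ‖ * (μ * |(k : ℝ)| ^ 2 * ‖θ‖ + |(k : ℝ)| * ‖g₁‖ + ‖g₃‖))
        + 2 * (‖θ‖ / δ * (μ * ‖D‖ + ‖g₂‖)) := by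
  have hw2 : ∀ y, |w y| ≤ 1 / 2 := by
    intro y
    have hpos : 0 < δ ^ 2 + y ^ 2 := by positivity
    rw [hw, abs_div, abs_of_pos hpos, div_le_iff₀ hpos, abs_le]
    constructor <;> nlinarith [sq_nonneg (δ - y), sq_nonneg (δ + y)]
  have htr := h.transport_le hθ hδ hκ hw hq
  have hκ0 : 0 < κ := by rw [hκ]; norm_num
  obtain ⟨he, he'⟩ := h.norm_e_le hκ0.le hδ.le hw2
  -- Here `κ` cancels, so the flux errors are not small in `κ`; the large weight on the plain energy
  -- absorbs the part containing `d`.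
  have he'' : ‖e'‖ ≤ ‖θ‖ / δ := by
    rw [le_div_iff₀ hδ]
    rw [mul_assoc] at he'
    linarith [le_of_mul_le_mul_left he' hκ0]
  have e0 : (inner ℂ (Complex.I • e) (bulkForce μ k g₁ g₃ θ)
        + inner ℂ (Complex.I • e') (fluxForce μ g₂ D)).re =
      k * (inner ℂ e (mulOp (.id ℝ) (mulOp (.id ℝ) θ))).re - μ * (k : ℝ) ^ 2 * (inner ℂ e θ).im
      - k * (inner ℂ e g₁).re - (inner ℂ e g₃).im + (inner ℂ e' g₂).im - μ * (inner ℂ e' D).im := by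
    have h2 : ((μ : ℂ) * (k : ℂ) ^ 2) = ((μ * (k : ℝ) ^ 2 : ℝ) : ℂ) := by push_cast; ring
    have h3 : Complex.I * (k : ℂ) = Complex.I * ((k : ℝ) : ℂ) := by push_cast; ring
    rw [bulkForce, fluxForce, h2, h3]
    simp only [inner_neg_right, inner_add_right, inner_sub_right, inner_smul_right,
      inner_smul_left, Complex.conj_I,
      Complex.add_re, Complex.sub_re, Complex.neg_re, Complex.sub_im,
      Complex.neg_im, mul_assoc, Complex.I_mul_re, Complex.I_mul_im, neg_mul,
      Complex.re_ofReal_mul, Complex.im_ofReal_mul, he0]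
    ring
  have bim : ∀ (c : ℝ) (x y : L2I), c * (inner ℂ x y).im ≤ |c| * (‖x‖ * ‖y‖) := by
    intro c x y
    refine (le_abs_self _).trans ?_
    rw [abs_mul]
    gcongr
    exact (Complex.abs_im_le_norm _).trans (norm_inner_le_norm _ _)
  have t1 := bim (-(σ * μ * (k : ℝ) ^ 2)) e θ
  have t2 : -(|(k : ℝ)| * (inner ℂ e g₁).re) ≤ |(k : ℝ)| * (‖e‖ * ‖g₁‖) := by
    rw [← mul_neg]
    gcongr
    exact (neg_le_abs _).trans (abs_re_inner_le _ _)
  have t3 := bim (-σ) e g₃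
  have t4 := bim σ e' g₂
  have t5 := bim (-(σ * μ)) e' D
  rw [abs_neg, abs_mul, abs_mul, hσ1, abs_of_pos hμ, abs_of_nonneg (sq_nonneg (k : ℝ)), one_mul,
    ← sq_abs] at t1
  rw [abs_neg, hσ1, one_mul] at t3
  rw [hσ1, one_mul] at t4
  rw [abs_neg, abs_mul, hσ1, abs_of_pos hμ, one_mul] at t5
  rw [e0]
  have htr' := mul_le_mul_of_nonneg_left htr (abs_nonneg (k : ℝ))
  have c1 : μ * |(k : ℝ)| ^ 2 * (‖e‖ * ‖θ‖) + |(k : ℝ)| * (‖e‖ * ‖g₁‖) + ‖e‖ * ‖g₃‖ ≤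
      κ * ‖θ‖ * (μ * |(k : ℝ)| ^ 2 * ‖θ‖ + |(k : ℝ)| * ‖g₁‖ + ‖g₃‖) := by
    calc _ = ‖e‖ * (μ * |(k : ℝ)| ^ 2 * ‖θ‖ + |(k : ℝ)| * ‖g₁‖ + ‖g₃‖) := by ring
      _ ≤ _ := by gcongr
  have c2 : ‖e'‖ * ‖g₂‖ + μ * (‖e'‖ * ‖D‖) ≤ ‖θ‖ / δ * (μ * ‖D‖ + ‖g₂‖) := by
    calc _ = ‖e'‖ * (μ * ‖D‖ + ‖g₂‖) := by ring
      _ ≤ _ := by gcongr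
  rw [← sq_abs (k : ℝ)]
  have s1 : σ * (k * (inner ℂ e (mulOp (.id ℝ) (mulOp (.id ℝ) θ))).re) =
      |(k : ℝ)| * (inner ℂ e (mulOp (.id ℝ) (mulOp (.id ℝ) θ))).re := by rw [← mul_assoc, hσ]
  have s2 : σ * (k * (inner ℂ e g₁).re) = |(k : ℝ)| * (inner ℂ e g₁).re := by rw [← mul_assoc, hσ]
  linarith

/-- Absorption of all error terms in the augmented energy functional. -/
theorem absorb_errors {Λ δ μ K m N d G₁ G₂ G₃ κ : ℝ} (hδ : 0 < δ) (hΛ : 0 < Λ)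
    (hμ : μ = Λ * δ ^ 2) (hK : K * δ ^ 2 = Λ) (hK0 : 0 < K) (hm : 1 ≤ m * (Λ + μ * K ^ 2))
    (hκ : κ = 1 / 36) (hN : 0 ≤ N) (hG₃ : 0 ≤ G₃) :
    40000 * (-(μ * K ^ 2 * N ^ 2) - μ * d ^ 2 + μ⁻¹ * (G₁ ^ 2 + G₂ ^ 2) + 2 * (N * G₃))
      + (K * (κ ^ 2 * (-(δ ^ 2 * N ^ 2) / 6 + 5 * δ ^ 4 * d ^ 2))
        + 2 * (κ * N * (μ * K ^ 2 * N + K * G₁ + G₃)) + 2 * (N / δ * (μ * d + G₂)))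
      ≤ -(1 / 31104) * (Λ * N ^ 2 + μ * K ^ 2 * N ^ 2 + μ * d ^ 2)
        + 10 ^ 14 * (μ⁻¹ * (G₁ ^ 2 + G₂ ^ 2) + m * G₃ ^ 2) := by
  have hμ0 : 0 < μ := by rw [hμ]; positivity
  have hX : μ * (N / δ) ^ 2 = Λ * N ^ 2 := by rw [hμ]; field_simp
  have e1 : K * (κ ^ 2 * (-(δ ^ 2 * N ^ 2) / 6 + 5 * δ ^ 4 * d ^ 2)) =
      κ ^ 2 * (-(Λ * N ^ 2) / 6 + 5 * (μ * d ^ 2)) := by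
    rw [hμ, ← hK]; ring
  have c1 : 2 * (N * (K * G₁)) ≤ μ * K ^ 2 * N ^ 2 + μ⁻¹ * G₁ ^ 2 := by
    have h : 0 ≤ μ⁻¹ * (μ * K * N - G₁) ^ 2 := by positivity
    have h' : μ⁻¹ * (μ * K * N - G₁) ^ 2 =
        μ * K ^ 2 * N ^ 2 + μ⁻¹ * G₁ ^ 2 - 2 * (N * (K * G₁)) := by
      field_simp
      ring
    linarith
  -- The gain `κ²/6` equals `4/31104`. Each of `c2`, `c3`, `c4` spends one quarter and the last
  -- quarter survives. The cost `31104 μd²` dictates the weight 40000.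
  have c2 : 2 * (N / δ * (μ * d)) ≤ 1 / 31104 * (Λ * N ^ 2) + 31104 * (μ * d ^ 2) := by
    rw [← hX]
    nlinarith [mul_nonneg hμ0.le (sq_nonneg (N / δ - 31104 * d))]
  have c3 : 2 * (N / δ * G₂) ≤ 1 / 31104 * (Λ * N ^ 2) + 31104 * (μ⁻¹ * G₂ ^ 2) := by
    rw [← hX]
    have h : 0 ≤ 1 / 31104 * μ⁻¹ * (μ * (N / δ) - 31104 * G₂) ^ 2 := by positivity
    have h' : 1 / 31104 * μ⁻¹ * (μ * (N / δ) - 31104 * G₂) ^ 2 =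
        1 / 31104 * (μ * (N / δ) ^ 2) + 31104 * (μ⁻¹ * G₂ ^ 2) - 2 * (N / δ * G₂) := by
      generalize N / δ = n
      field_simp
      ring
    linarith
  -- `80001` bounds `2·40000 + 2κ`, and `10^14` bounds `31104·80001²/4`.
  have c4 : 80001 * (N * G₃) ≤ 1 / 31104 * (Λ * N ^ 2 + μ * K ^ 2 * N ^ 2)
      + 10 ^ 14 * (m * G₃ ^ 2) := by
    set S := Λ + μ * K ^ 2 with hS
    have hS0 : 0 < S := by positivity
    have h1 : S⁻¹ * G₃ ^ 2 ≤ m * G₃ ^ 2 := by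
      gcongr
      rw [inv_le_iff_one_le_mul₀ hS0]
      exact hm
    have h : 0 ≤ 1 / 31104 * S⁻¹ * (S * N - 31104 * 80001 / 2 * G₃) ^ 2 := by positivity
    have h' : 1 / 31104 * S⁻¹ * (S * N - 31104 * 80001 / 2 * G₃) ^ 2 =
        1 / 31104 * (S * N ^ 2) + 31104 * 80001 ^ 2 / 4 * (S⁻¹ * G₃ ^ 2) - 80001 * (N * G₃) := by
      field_simp
      ring
    have h3 : 0 ≤ m * G₃ ^ 2 := le_trans (by positivity) h1
    have h4 : S * N ^ 2 = Λ * N ^ 2 + μ * K ^ 2 * N ^ 2 := by rw [hS]; ring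
    rw [h4] at h'
    linarith
  have p1 : 0 ≤ μ * K ^ 2 * N ^ 2 := by positivity
  have p2 : 0 ≤ μ * d ^ 2 := by positivity
  have p3 : 0 ≤ μ⁻¹ * G₁ ^ 2 := by positivity
  have p4 : 0 ≤ μ⁻¹ * G₂ ^ 2 := by positivity
  have p5 : 0 ≤ Λ * N ^ 2 := by positivity
  have p6 : 0 ≤ N * G₃ := by positivity
  rw [e1, hκ]
  linarith

/-- The augmented energy estimate on `(0, T)`. -/
theorem IsTempSolution.energy_le {μ : ℝ} {k : ℤ} {θ₀ : L2I} {g₁ g₂ g₃ θ Dθ : ℝ → L2I}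
    (h : IsTempSolution μ k θ₀ g₁ g₂ g₃ θ Dθ) (hk : k ≠ 0)
    (h₁ : MemLp g₁ 2 volT) (h₂ : MemLp g₂ 2 volT) (h₃ : MemLp g₃ 2 volT)
    {Λ δ m : ℝ} (hδ : 0 < δ) (hΛ : 0 < Λ) (hμ : μ = Λ * δ ^ 2) (hkδ : |(k : ℝ)| * δ ^ 2 = Λ)
    (hm : 1 ≤ m * (Λ + μ * |(k : ℝ)| ^ 2)) {T : ℝ} (hT : 0 < T) :
    ‖θ T‖ ^ 2 + 1 / 31104 * ∫ t in Ioo 0 T,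
        (Λ * ‖θ t‖ ^ 2 + μ * |(k : ℝ)| ^ 2 * ‖θ t‖ ^ 2 + μ * ‖Dθ t‖ ^ 2)
      ≤ 40001 * ‖θ₀‖ ^ 2 + 10 ^ 14 * ∫ t in Ioo 0 T,
        (μ⁻¹ * (‖g₁ t‖ ^ 2 + ‖g₂ t‖ ^ 2) + m * ‖g₃ t‖ ^ 2) := by
  have hμ0 : 0 < μ := by rw [hμ]; positivity
  have hK0 : 0 < |(k : ℝ)| := abs_pos.2 (by exact_mod_cast hk)
  obtain ⟨σ, hσ1, hσ⟩ : ∃ σ : ℝ, |σ| = 1 ∧ σ * k = |(k : ℝ)| := by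
    rcases abs_cases (k : ℝ) with ⟨h, -⟩ | ⟨h, -⟩
    · exact ⟨1, by simp, by rw [h, one_mul]⟩
    · exact ⟨-1, by simp, by rw [h, neg_one_mul]⟩
  obtain ⟨κ, hκ⟩ : ∃ κ : ℝ, κ = 1 / 36 := ⟨_, rfl⟩
  have hκ0 : 0 < κ := by rw [hκ]; norm_num
  have hpos : ∀ y : ℝ, δ ^ 2 + y ^ 2 ≠ 0 := fun y => by positivity
  obtain ⟨w, hw⟩ : ∃ w : C(ℝ, ℝ), ∀ y, w y = δ * y / (δ ^ 2 + y ^ 2) :=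
    ⟨⟨fun y => δ * y / (δ ^ 2 + y ^ 2), by
      exact Continuous.div (by fun_prop) (by fun_prop) hpos⟩, fun y => rfl⟩
  obtain ⟨q, hq⟩ : ∃ q : C(ℝ, ℝ), ∀ y, q y = y ^ 2 / (δ ^ 2 + y ^ 2) :=
    ⟨⟨fun y => y ^ 2 / (δ ^ 2 + y ^ 2), by
      exact Continuous.div (by fun_prop) (by fun_prop) hpos⟩, fun y => rfl⟩
  have hw2 : ∀ y, |w y| ≤ 1 / 2 := by
    intro y
    have hpos : 0 < δ ^ 2 + y ^ 2 := by positivity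
    rw [hw, abs_div, abs_of_pos hpos, div_le_iff₀ hpos, abs_le]
    constructor <;> nlinarith [sq_nonneg (δ - y), sq_nonneg (δ + y)]
  set ε := κ * δ with hε
  have hε0 : ε ≠ 0 := by positivity
  let A := commutatorOp ε κ w
  let B : L2I →L[ℂ] L2I := Complex.I • A
  let e' : L2I →L[ℂ] L2I := ((ε : ℝ)⁻¹ : ℂ) • (WithLp.sndL 2 ℂ L2I L2I ∘L commutatorLift ε κ w)
  have hA := fun x => isMollifiedCommutator_commutatorLift hε0 w x
  have hBs : ∀ x y, inner ℂ (B x) y = inner ℂ x (B y) := by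
    intro x y
    change inner ℂ (Complex.I • A x) y = inner ℂ x (Complex.I • A y)
    rw [inner_smul_left, inner_smul_right, inner_commutatorOp, Complex.conj_I]
    ring
  have hA0 : ∀ x, (inner ℂ (A x) x).re = 0 := by
    intro x
    have e1 := congrArg Complex.re (inner_commutatorOp ε κ w x x)
    rw [Complex.neg_re, re_inner_symm x] at e1
    change (inner ℂ (A x) x).re = -(inner ℂ (A x) x).re at e1
    linarith
  have hBn : ∀ x, |(inner ℂ (B x) x).re| ≤ ‖x‖ ^ 2 := by
    intro x
    refine (abs_re_inner_le _ _).trans ?_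
    change ‖Complex.I • A x‖ * ‖x‖ ≤ _
    rw [norm_smul, Complex.norm_I, one_mul, sq]
    gcongr
    refine ((hA x).norm_e_le hκ0.le hδ.le hw2).1.trans ?_
    refine mul_le_of_le_one_left (norm_nonneg _) ?_
    rw [hκ]; norm_num
  have hQs : ∀ x y : L2I, inner ℂ ((1 : L2I →L[ℂ] L2I) x) y =
      inner ℂ x ((1 : L2I →L[ℂ] L2I) y) := fun x y => rfl
  -- The energy identity is applied to the identity operator here and to `B = iA` in `E2`.
  have E1 := h.re_inner_sub_eq h₁ h₂ h₃ 1 hQs (P := Dθ) h.memLp_deriv h.dirichlet hT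
  have hPm : ∀ T : ℝ, 0 < T → MemLp (fun t => Complex.I • e' (θ t)) 2
      (volume.restrict (Ioo 0 T)) := fun T _ => (Complex.I • e').comp_memLp' (h.memLp_theta T)
  have E2 := h.re_inner_sub_eq h₁ h₂ h₃ B hBs hPm
    (ae_of_all _ fun t => (hA (θ t)).h10_e.smul Complex.I) hT
  simp only [one_apply_eq_self, re_inner_self] at E1
  have hres : volume.restrict (Ioo 0 T) ≤ volT := Measure.restrict_mono Ioo_subset_Ioi_self le_rfl
  have mH := h.memLp_bulkForce h₁ h₃ T
  have mG := h.memLp_fluxForce h₂ hT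
  have mθ := h.memLp_theta T
  have mD := h.memLp_deriv T hT
  have i1 : Integrable (fun t => 2 * (inner ℂ (θ t) (bulkForce μ k (g₁ t) (g₃ t) (θ t))
      + inner ℂ (Dθ t) (fluxForce μ (g₂ t) (Dθ t))).re) (volume.restrict (Ioo 0 T)) :=
    (((integrable_inner_of_memLp mθ mH).add (integrable_inner_of_memLp mD mG)).re).const_mul 2
  have i2 : Integrable (fun t => 2 * (inner ℂ (B (θ t)) (bulkForce μ k (g₁ t) (g₃ t) (θ t))
      + inner ℂ (Complex.I • e' (θ t)) (fluxForce μ (g₂ t) (Dθ t))).re)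
      (volume.restrict (Ioo 0 T)) := (((integrable_inner_of_memLp (B.comp_memLp' mθ) mH).add
    (integrable_inner_of_memLp (hPm T hT) mG)).re).const_mul 2
  have nθ := mθ.integrable_norm_pow (by norm_num)
  have nD := mD.integrable_norm_pow (by norm_num)
  have n1 := (h₁.mono_measure hres).integrable_norm_pow (by norm_num)
  have n2 := (h₂.mono_measure hres).integrable_norm_pow (by norm_num)
  have n3 := (h₃.mono_measure hres).integrable_norm_pow (by norm_num)
  have iL : Integrable (fun t => Λ * ‖θ t‖ ^ 2 + μ * |(k : ℝ)| ^ 2 * ‖θ t‖ ^ 2 + μ * ‖Dθ t‖ ^ 2)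
      (volume.restrict (Ioo 0 T)) := ((nθ.const_mul _).add (nθ.const_mul _)).add (nD.const_mul _)
  have iR : Integrable (fun t => μ⁻¹ * (‖g₁ t‖ ^ 2 + ‖g₂ t‖ ^ 2) + m * ‖g₃ t‖ ^ 2)
      (volume.restrict (Ioo 0 T)) := ((n1.add n2).const_mul _).add (n3.const_mul _)
  have mono : (∫ t in Ioo 0 T, (40000 * (2 * (inner ℂ (θ t) (bulkForce μ k (g₁ t) (g₃ t) (θ t))
          + inner ℂ (Dθ t) (fluxForce μ (g₂ t) (Dθ t))).re)
        + σ * (2 * (inner ℂ (B (θ t)) (bulkForce μ k (g₁ t) (g₃ t) (θ t))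
          + inner ℂ (Complex.I • e' (θ t)) (fluxForce μ (g₂ t) (Dθ t))).re))) ≤
      ∫ t in Ioo 0 T, (-(1 / 31104) * (Λ * ‖θ t‖ ^ 2 + μ * |(k : ℝ)| ^ 2 * ‖θ t‖ ^ 2
          + μ * ‖Dθ t‖ ^ 2)
        + 10 ^ 14 * (μ⁻¹ * (‖g₁ t‖ ^ 2 + ‖g₂ t‖ ^ 2) + m * ‖g₃ t‖ ^ 2)) := by
    refine integral_mono_ae ((i1.const_mul 40000).add (i2.const_mul σ))
      ((iL.const_mul _).add (iR.const_mul _)) ?_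
    filter_upwards [ae_mono hres h.dirichlet] with t ht
    have b1 := re_energy_le hμ0 k (θ t) (Dθ t) (g₁ t) (g₂ t) (g₃ t)
    have b2 := (hA (θ t)).re_hypocoercive_le ht hδ hκ hw hq (hA0 (θ t)) hμ0 hσ hσ1
      (g₁ t) (g₂ t) (g₃ t)
    have b3 := absorb_errors (d := ‖Dθ t‖) (G₁ := ‖g₁ t‖) (G₂ := ‖g₂ t‖) hδ hΛ hμ hkδ hK0 hm hκ
      (norm_nonneg (θ t)) (norm_nonneg (g₃ t))
    exact (add_le_add (mul_le_mul_of_nonneg_left b1 (by norm_num)) b2).trans b3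
  rw [integral_add (i1.const_mul 40000) (i2.const_mul σ), integral_const_mul 40000,
    integral_const_mul σ, integral_add (iL.const_mul _) (iR.const_mul _),
    integral_const_mul (-(1 / 31104)), integral_const_mul (10 ^ 14)] at mono
  rw [← E1, ← E2, mul_sub, mul_sub] at mono
  -- The correction is at most `‖θ‖²` in modulus, so the functional lies between `39999 ‖θ‖²` and
  -- `40001 ‖θ‖²`.
  have q1 : -‖θ T‖ ^ 2 ≤ σ * (inner ℂ (B (θ T)) (θ T)).re := by
    have := (neg_abs_le (σ * (inner ℂ (B (θ T)) (θ T)).re))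
    rw [abs_mul, hσ1, one_mul] at this
    linarith [hBn (θ T)]
  have q2 : σ * (inner ℂ (B θ₀) θ₀).re ≤ ‖θ₀‖ ^ 2 := by
    have := (le_abs_self (σ * (inner ℂ (B θ₀) θ₀).re))
    rw [abs_mul, hσ1, one_mul] at this
    linarith [hBn θ₀]
  have q3 : 0 ≤ ‖θ T‖ ^ 2 := by positivity
  linarith

/-! ### Passage to all times and to extended norms. -/

theorem eLpNorm_two_sq {ν : Measure ℝ} (v : ℝ → L2I) :
    eLpNorm v 2 ν ^ 2 = ∫⁻ t, ENNReal.ofReal (‖v t‖ ^ 2) ∂ν := by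
  have := eLpNorm_nnreal_pow_eq_lintegral (f := v) (μ := ν) (p := 2) (by norm_num)
  simp only [NNReal.coe_ofNat, ENNReal.coe_ofNat, ENNReal.rpow_ofNat] at this
  rw [this]
  refine lintegral_congr fun t => ?_
  rw [ENNReal.ofReal_pow (norm_nonneg _), ofReal_norm]

theorem eLpNorm_two_sq_eq_ofReal {ν : Measure ℝ} {v : ℝ → L2I} (hv : MemLp v 2 ν) :
    eLpNorm v 2 ν ^ 2 = ENNReal.ofReal (∫ t, ‖v t‖ ^ 2 ∂ν) := by
  rw [eLpNorm_two_sq, ofReal_integral_eq_lintegral_ofReal (hv.integrable_norm_pow (by norm_num))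
    (ae_of_all _ fun t => by positivity)]

/-- Monotone convergence along `(0, n + 1)`; global square integrability is not known beforehand. -/
theorem eLpNorm_two_sq_le_of_forall {v : ℝ → L2I} {M : ℝ}
    (hv : ∀ T : ℝ, 0 < T → MemLp v 2 (volume.restrict (Ioo 0 T)))
    (h : ∀ T : ℝ, 0 < T → ∫ t in Ioo 0 T, ‖v t‖ ^ 2 ≤ M) :
    eLpNorm v 2 volT ^ 2 ≤ ENNReal.ofReal M := by
  have hU : Ioi (0 : ℝ) = ⋃ n : ℕ, Ioo (0 : ℝ) (n + 1) := by
    ext t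
    simp only [mem_Ioi, mem_iUnion, mem_Ioo, exists_and_left]
    refine ⟨fun ht => ⟨ht, ?_⟩, fun ht => ht.1⟩
    obtain ⟨n, hn⟩ := exists_nat_gt t
    exact ⟨n, by linarith⟩
  have hmono : Monotone fun n : ℕ => Ioo (0 : ℝ) (n + 1) := fun a b hab =>
    Ioo_subset_Ioo_right (by
      have : (a : ℝ) ≤ b := by exact_mod_cast hab
      linarith)
  rw [eLpNorm_two_sq, volT, hU, setLIntegral_iUnion_of_directed _ hmono.directed_le]
  refine iSup_le fun n => ?_
  have hn : (0 : ℝ) < n + 1 := by positivity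
  rw [← eLpNorm_two_sq, eLpNorm_two_sq_eq_ofReal (hv _ hn)]
  exact ENNReal.ofReal_le_ofReal (h _ hn)

theorem ofReal_mul_eLpNorm_two_sq_le {v : ℝ → L2I} {c M : ℝ} (hc : 0 < c)
    (hv : ∀ T : ℝ, 0 < T → MemLp v 2 (volume.restrict (Ioo 0 T)))
    (h : ∀ T : ℝ, 0 < T → c * ∫ t in Ioo 0 T, ‖v t‖ ^ 2 ≤ M) :
    ENNReal.ofReal c * eLpNorm v 2 volT ^ 2 ≤ ENNReal.ofReal M := by
  have := eLpNorm_two_sq_le_of_forall (M := M / c) hv fun T hT => by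
    rw [le_div_iff₀' hc]
    exact h T hT
  refine (mul_le_mul_right this _).trans ?_
  rw [← ENNReal.ofReal_mul hc.le, mul_div_cancel₀ _ hc.ne']

theorem eLpNorm_top_sq_le_of_forall {v : ℝ → L2I} {M : ℝ} (hM : 0 ≤ M)
    (h : ∀ T : ℝ, 0 < T → ‖v T‖ ^ 2 ≤ M) : eLpNorm v ∞ volT ^ 2 ≤ ENNReal.ofReal M := by
  have : eLpNorm v ∞ volT ≤ ENNReal.ofReal (Real.sqrt M) := by
    rw [eLpNorm_exponent_top]
    refine eLpNormEssSup_le_of_ae_bound ?_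
    filter_upwards [ae_restrict_mem measurableSet_Ioi] with t ht
    exact Real.le_sqrt_of_sq_le (h t ht)
  calc eLpNorm v ∞ volT ^ 2 ≤ ENNReal.ofReal (Real.sqrt M) ^ 2 := by gcongr
    _ = _ := by rw [← ENNReal.ofReal_pow (Real.sqrt_nonneg _), Real.sq_sqrt hM]

/-- This lets `g₃` be absorbed by the sum of the enhanced and the `μk²` dissipation, which produces
the minimum in the estimate. -/
theorem one_le_min_inv_mul_add {a b : ℝ} (ha : 0 < a) (hb : 0 < b) :
    1 ≤ min a⁻¹ b⁻¹ * (a + b) := by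
  rcases min_choice a⁻¹ b⁻¹ with h | h
  · rw [h, mul_add, inv_mul_cancel₀ ha.ne']
    linarith [mul_pos (inv_pos.2 ha) hb]
  · rw [h, mul_add, inv_mul_cancel₀ hb.ne']
    linarith [mul_pos (inv_pos.2 hb) ha]

/-- The energy estimate with the right-hand side integrated over all times. -/
theorem IsTempSolution.energy_le_total {μ : ℝ} {k : ℤ} {θ₀ : L2I} {g₁ g₂ g₃ θ Dθ : ℝ → L2I}
    {Λ m : ℝ} (hsol : IsTempSolution μ k θ₀ g₁ g₂ g₃ θ Dθ) (hμ : 0 < μ) (hk : k ≠ 0)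
    (h₁ : MemLp g₁ 2 volT) (h₂ : MemLp g₂ 2 volT) (h₃ : MemLp g₃ 2 volT)
    (hΛ : 0 < Λ) (hΛ2 : Λ ^ 2 = μ * |(k : ℝ)|) (hm0 : 0 ≤ m)
    (hm : 1 ≤ m * (Λ + μ * |(k : ℝ)| ^ 2)) {T : ℝ} (hT : 0 < T) :
    ‖θ T‖ ^ 2 + 1 / 31104 * (Λ * (∫ t in Ioo 0 T, ‖θ t‖ ^ 2)
      + μ * |(k : ℝ)| ^ 2 * (∫ t in Ioo 0 T, ‖θ t‖ ^ 2) + μ * (∫ t in Ioo 0 T, ‖Dθ t‖ ^ 2)) ≤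
    10 ^ 14 * (‖θ₀‖ ^ 2 + μ⁻¹ * ((∫ t, ‖g₁ t‖ ^ 2 ∂volT) + ∫ t, ‖g₂ t‖ ^ 2 ∂volT)
      + m * ∫ t, ‖g₃ t‖ ^ 2 ∂volT) := by
  have hK : 0 < |(k : ℝ)| := abs_pos.2 (by exact_mod_cast hk)
  set K := |(k : ℝ)|
  -- `δ = (Λ/K)^(1/2) = (μ/K)^(1/4)` balances `Kδ² = Λ` with `Kδ⁴ = μ`.
  have hδ2 : Real.sqrt (Λ / K) ^ 2 = Λ / K := Real.sq_sqrt (by positivity)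
  have hδ : 0 < Real.sqrt (Λ / K) := Real.sqrt_pos.2 (by positivity)
  have e1 : μ = Λ * Real.sqrt (Λ / K) ^ 2 := by
    rw [hδ2, ← mul_div_assoc, ← sq, hΛ2]; field_simp
  have e2 : K * Real.sqrt (Λ / K) ^ 2 = Λ := by rw [hδ2]; field_simp
  have n1 := h₁.integrable_norm_pow (by norm_num)
  have n2 := h₂.integrable_norm_pow (by norm_num)
  have n3 := h₃.integrable_norm_pow (by norm_num)
  have iR : Integrable (fun t => μ⁻¹ * (‖g₁ t‖ ^ 2 + ‖g₂ t‖ ^ 2) + m * ‖g₃ t‖ ^ 2) volT :=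
    ((n1.add n2).const_mul _).add (n3.const_mul _)
  have eR : ∫ t, (μ⁻¹ * (‖g₁ t‖ ^ 2 + ‖g₂ t‖ ^ 2) + m * ‖g₃ t‖ ^ 2) ∂volT =
      μ⁻¹ * ((∫ t, ‖g₁ t‖ ^ 2 ∂volT) + ∫ t, ‖g₂ t‖ ^ 2 ∂volT) + m * ∫ t, ‖g₃ t‖ ^ 2 ∂volT := by
    have n12 : Integrable (fun t => μ⁻¹ * (‖g₁ t‖ ^ 2 + ‖g₂ t‖ ^ 2)) volT :=
      (n1.add n2).const_mul μ⁻¹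
    rw [integral_add n12 (n3.const_mul m), integral_const_mul μ⁻¹,
      integral_const_mul m, integral_add n1 n2]
  have hle : ∫ t in Ioo 0 T, (μ⁻¹ * (‖g₁ t‖ ^ 2 + ‖g₂ t‖ ^ 2) + m * ‖g₃ t‖ ^ 2) ≤
      ∫ t, (μ⁻¹ * (‖g₁ t‖ ^ 2 + ‖g₂ t‖ ^ 2) + m * ‖g₃ t‖ ^ 2) ∂volT :=
    integral_mono_measure (Measure.restrict_mono Ioo_subset_Ioi_self le_rfl)
      (ae_of_all _ fun t => by positivity) iR
  rw [eR] at hle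
  have main := hsol.energy_le hk h₁ h₂ h₃ hδ hΛ e1 e2 hm hT
  have nθ := (hsol.memLp_theta T).integrable_norm_pow (by norm_num)
  have nD := (hsol.memLp_deriv T hT).integrable_norm_pow (by norm_num)
  have nθ2 : Integrable (fun t => Λ * ‖θ t‖ ^ 2 + μ * K ^ 2 * ‖θ t‖ ^ 2)
      (volume.restrict (Ioo 0 T)) := (nθ.const_mul Λ).add (nθ.const_mul (μ * K ^ 2))
  rw [integral_add nθ2 (nD.const_mul μ),
    integral_add (nθ.const_mul Λ) (nθ.const_mul (μ * K ^ 2)), integral_const_mul Λ,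
    integral_const_mul (μ * K ^ 2), integral_const_mul μ] at main
  have h0 : 0 ≤ ‖θ₀‖ ^ 2 := by positivity
  linarith

theorem proposition4p6 :
    ∃ C : ℝ, 0 < C ∧
      ∀ (μ : ℝ) (k : ℤ), 0 < μ → k ≠ 0 →
      ∀ (θ₀ : L2I) (g₁ g₂ g₃ θ Dθ : ℝ → L2I),
        MemLp g₁ 2 volT → MemLp g₂ 2 volT → MemLp g₃ 2 volT →
        IsTempSolution μ k θ₀ g₁ g₂ g₃ θ Dθ →
        eLpNorm θ ∞ volT ^ 2
            + ENNReal.ofReal ((μ * |(k : ℝ)|) ^ (1 / 2 : ℝ)) * eLpNorm θ 2 volT ^ 2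
            + ENNReal.ofReal μ *
                (eLpNorm Dθ 2 volT ^ 2 + ENNReal.ofReal ((k : ℝ) ^ 2) * eLpNorm θ 2 volT ^ 2)
          ≤ ENNReal.ofReal C *
              (‖θ₀‖ₑ ^ 2
                + ENNReal.ofReal μ⁻¹ * (eLpNorm g₁ 2 volT ^ 2 + eLpNorm g₂ 2 volT ^ 2)
                + ENNReal.ofReal
                    (min ((μ * |(k : ℝ)|) ^ (-(1 / 2) : ℝ)) (μ * (k : ℝ) ^ 2)⁻¹) *
                  eLpNorm g₃ 2 volT ^ 2) := by
  -- `10^19` exceeds `(1 + 3·31104)·10^14`, the sum of the bounds for the four terms on the left.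
  refine ⟨10 ^ 19, by norm_num, ?_⟩
  intro μ k hμ hk θ₀ g₁ g₂ g₃ θ Dθ h₁ h₂ h₃ hsol
  have hK : 0 < |(k : ℝ)| := abs_pos.2 (by exact_mod_cast hk)
  have hμK : 0 < μ * |(k : ℝ)| := mul_pos hμ hK
  rw [Real.rpow_neg hμK.le, ← sq_abs (k : ℝ)]
  set K := |(k : ℝ)|
  set Λ := (μ * K) ^ (1 / 2 : ℝ)
  have hΛ : 0 < Λ := Real.rpow_pos_of_pos hμK _
  have hΛ2 : Λ ^ 2 = μ * K := by
    rw [← Real.rpow_natCast, ← Real.rpow_mul hμK.le]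
    norm_num
  set m := min Λ⁻¹ (μ * K ^ 2)⁻¹ with hmdef
  have hμK2 : 0 < μ * K ^ 2 := by positivity
  have hm0 : 0 < m := lt_min (inv_pos.2 hΛ) (inv_pos.2 hμK2)
  have hm : 1 ≤ m * (Λ + μ * K ^ 2) := one_le_min_inv_mul_add hΛ hμK2
  set a₁ := ∫ t, ‖g₁ t‖ ^ 2 ∂volT with ha₁
  set a₂ := ∫ t, ‖g₂ t‖ ^ 2 ∂volT with ha₂
  set a₃ := ∫ t, ‖g₃ t‖ ^ 2 ∂volT with ha₃
  have p₁ : 0 ≤ a₁ := integral_nonneg fun t => by positivity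
  have p₂ : 0 ≤ a₂ := integral_nonneg fun t => by positivity
  have p₃ : 0 ≤ a₃ := integral_nonneg fun t => by positivity
  set S := ‖θ₀‖ ^ 2 + μ⁻¹ * (a₁ + a₂) + m * a₃ with hS
  have hS0 : 0 ≤ S := by positivity
  have main : ∀ T : ℝ, 0 < T → _ := fun T hT =>
    hsol.energy_le_total hμ hk h₁ h₂ h₃ hΛ hΛ2 hm0.le hm hT
  have q1 : ∀ T : ℝ, 0 ≤ ∫ t in Ioo 0 T, ‖θ t‖ ^ 2 := fun T =>
    integral_nonneg fun t => by positivity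
  have q2 : ∀ T : ℝ, 0 ≤ ∫ t in Ioo 0 T, ‖Dθ t‖ ^ 2 := fun T =>
    integral_nonneg fun t => by positivity
  have q3 : ∀ T : ℝ, 0 ≤ ‖θ T‖ ^ 2 := fun T => by positivity
  have r1 : ENNReal.ofReal Λ * eLpNorm θ 2 volT ^ 2 ≤
      ENNReal.ofReal (31104 * (10 ^ 14 * S)) :=
    ofReal_mul_eLpNorm_two_sq_le hΛ (fun T _ => hsol.memLp_theta T) fun T hT => by
      linarith [main T hT, q3 T, mul_nonneg hμK2.le (q1 T), mul_nonneg hμ.le (q2 T)]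
  have r2 : ENNReal.ofReal μ * (ENNReal.ofReal (K ^ 2) * eLpNorm θ 2 volT ^ 2) ≤
      ENNReal.ofReal (31104 * (10 ^ 14 * S)) := by
    rw [← mul_assoc, ← ENNReal.ofReal_mul hμ.le]
    exact ofReal_mul_eLpNorm_two_sq_le hμK2 (fun T _ => hsol.memLp_theta T) fun T hT => by
      linarith [main T hT, q3 T, mul_nonneg hΛ.le (q1 T), mul_nonneg hμ.le (q2 T)]
  have r3 : ENNReal.ofReal μ * eLpNorm Dθ 2 volT ^ 2 ≤
      ENNReal.ofReal (31104 * (10 ^ 14 * S)) :=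
    ofReal_mul_eLpNorm_two_sq_le hμ hsol.memLp_deriv fun T hT => by
      linarith [main T hT, q3 T, mul_nonneg hΛ.le (q1 T), mul_nonneg hμK2.le (q1 T)]
  have r4 : eLpNorm θ ∞ volT ^ 2 ≤ ENNReal.ofReal (10 ^ 14 * S) :=
    eLpNorm_top_sq_le_of_forall (by positivity) fun T hT => by
      linarith [main T hT, mul_nonneg hΛ.le (q1 T), mul_nonneg hμK2.le (q1 T),
        mul_nonneg hμ.le (q2 T)]
  have eRHS : ‖θ₀‖ₑ ^ 2 + ENNReal.ofReal μ⁻¹ * (eLpNorm g₁ 2 volT ^ 2 + eLpNorm g₂ 2 volT ^ 2)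
      + ENNReal.ofReal m * eLpNorm g₃ 2 volT ^ 2 = ENNReal.ofReal S := by
    rw [eLpNorm_two_sq_eq_ofReal h₁, eLpNorm_two_sq_eq_ofReal h₂, eLpNorm_two_sq_eq_ofReal h₃,
      ← ofReal_norm, ← ENNReal.ofReal_pow (norm_nonneg _), ← ENNReal.ofReal_add p₁ p₂,
      ← ENNReal.ofReal_mul (by positivity), ← ENNReal.ofReal_mul hm0.le,
      ← ENNReal.ofReal_add (by positivity) (by positivity),
      ← ENNReal.ofReal_add (by positivity) (by positivity)]
  rw [eRHS, ← ENNReal.ofReal_mul (by norm_num), mul_add]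
  refine (add_le_add (add_le_add r4 r1) (add_le_add r3 r2)).trans ?_
  rw [← ENNReal.ofReal_add (by positivity) (by positivity),
    ← ENNReal.ofReal_add (by positivity) (by positivity),
    ← ENNReal.ofReal_add (by positivity) (by positivity)]
  refine ENNReal.ofReal_le_ofReal ?_
  linarith
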